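/- **Conventions.** All $C^*$-algebras are unital, and $\otimes$ is the spatial (minimal) tensor product of $C^*$-algebras. A square matrix over a $*$-algebra is biunitary if it and its transpose are unitary. $C(U_n^+)$ is the universal $C^*$-algebra generated by the entries $u_{ij}$ of a biunitary $n\times n$ matrix $u$, with comultiplication $\Delta(u_{ij})=\sum_s u_{is}\otimes u_{sj}$. A quantum subgroup $G\subset U_n^+$ is a $C^*$-algebra $C(G)$ with a comultiplication $\Delta$ and a surjective $*$-homomorphism $C(U_n^+)\to C(G)$ intertwining the comultiplications; the images of the $u_{ij}$ in $C(G)$ are again denoted $u_{ij}$. Two quantum subgroups of $U_n^+$ are identified if there is a $C^*$-isomorphism between their algebras which intertwines the comultiplications and the maps from $C(U_n^+)$. For $k\le n$, $U_k^+\subset U_n^+$ is given by $u\mapsto\mathrm{diag}(v,1_{n-k})$, where $v$ is the generating matrix of $C(U_k^+)$. The intersection $G\cap H$ of two quantum subgroups is the quantum subgroup for which $\ker(C(U_n^+)\to C(G\cap H))$ is the sum of $\ker(C(U_n^+)\to C(G))$ and $\ker(C(U_n^+)\to C(H))$. For quantum subgroups $H\subset G$ with corresponding surjection $\pi:C(G)\to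 C(H)$, let $$C(G/H)=\{f\in C(G)\mid(\pi\otimes\mathrm{id})\Delta f=1\otimes f\},$$ and for $H=G\cap U_k^+$ let $C_\times(G/H)\subset C(G)$ be the $C^*$-subalgebra generated by $1$ and the $u_{ij}$ with $i>k$, $1\le j\le n$. For a discrete group $\Gamma$, $C^*(\Gamma)$ is the full group $C^*$-algebra with $\Delta(g)=g\otimes g$ for $g\in\Gamma$. If $\Gamma=\langle g_1,\dots,g_n\rangle$ and $J\in U_n$ is a unitary matrix, then $\widehat\Gamma\subset U_n^+$ denotes the quantum subgroup with $C(\widehat\Gamma)=C^*(\Gamma)$ embedded via $u\mapsto JDJ^*$, where $D=\mathrm{diag}(g_1,\dots,g_n)$. **Theorem 2.5 (Theorem A).** Let $\Gamma=\langle g_1,\dots,g_n\rangle$ be a discrete group, let $J\in U_n$ and $k\le n$, let $G=\widehat\Gamma\subset U_n^+$ be embedded via $u\mapsto JDJ^*$, and let $H=G\cap U_k^+$. 1. $H=\widehat\Theta$, where $\Theta=\Gamma/\langle g_r=1\mid\exists\,i>k,\ J_{ir}\ne0\rangle$ is the quotient of $\Gamma$ by the normal subgroup generated by these $g_r$, embedded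 via $u\mapsto JDJ^*$ with $D=\mathrm{diag}(\bar g_1,\dots,\bar g_n)$, where $\bar g_r\in\Theta$ is the class of $g_r$. 2. $C_\times(G/H)=C^*(\Lambda)$, where $\Lambda=\langle g_r\mid\exists\,i>k,\ J_{ir}\ne0\rangle\subset\Gamma$. 3. $C(G/H)=C^*(\Lambda')$, where $\Lambda'$ is the normal closure of $\Lambda$ in $\Gamma$, i.e. the smallest normal subgroup of $\Gamma$ containing $\Lambda$. 4. $C_\times(G/H)=C(G/H)$ if and only if $\Lambda$ is a normal subgroup of $\Gamma$. In 2 and 3, the equalities mean that the canonical $*$-homomorphisms $C^*(\Lambda)\to C^*(\Gamma)$ and $C^*(\Lambda')\to C^*(\Gamma)$ are injective, with images $C_\times(G/H)$ and $C(G/H)$. -/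

import Mathlib

open scoped TensorProduct

universe u v

namespace QSpace

noncomputable section

section Completion

/-- A C*-seminorm on a unital complex *-algebra. -/
structure CStarSeminorm (A : Type u) [Ring A] [StarRing A] [Algebra ℂ A] where
  toSeminorm : Seminorm ℂ A
  mul_le : ∀ a b, toSeminorm (a * b) ≤ toSeminorm a * toSeminorm b
  star_mul_self : ∀ a, toSeminorm (star a * a) = toSeminorm a * toSeminorm a

variable {A : Type u} [Ring A] [StarRing A] [Algebra ℂ A]

instance : CoeFun (CStarSeminorm A) (fun _ => A → ℝ) := ⟨fun p => p.toSeminorm⟩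

namespace CStarSeminorm

theorem nonneg (p : CStarSeminorm A) (a : A) : 0 ≤ p a := apply_nonneg p.toSeminorm a

theorem le_star (p : CStarSeminorm A) (a : A) : p a ≤ p (star a) := by
  have h1 := p.star_mul_self a
  have h2 := p.mul_le (star a) a
  rcases (p.nonneg a).eq_or_lt with h | h
  · rw [← h]; exact p.nonneg _
  · nlinarith

theorem star_eq (p : CStarSeminorm A) (a : A) : p (star a) = p a :=
  le_antisymm (by simpa using p.le_star (star a)) (p.le_star a)

theorem one_le (p : CStarSeminorm A) : p 1 ≤ 1 := by
  have h1 := p.star_mul_self 1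
  have h2 := p.nonneg 1
  simp only [star_one, mul_one] at h1
  nlinarith

/-- The C*-seminorm `a ↦ ‖f a‖` of a *-homomorphism into a C*-algebra. -/
def ofHom {B : Type v} [CStarAlgebra B] (f : A →⋆ₐ[ℂ] B) : CStarSeminorm A where
  toSeminorm := (normSeminorm ℂ B).comp f.toAlgHom.toLinearMap
  mul_le a b := by
    change ‖f (a * b)‖ ≤ ‖f a‖ * ‖f b‖
    rw [map_mul]; exact norm_mul_le _ _
  star_mul_self a := by
    change ‖f (star a * a)‖ = ‖f a‖ * ‖f a‖
    rw [map_mul, map_star, CStarRing.norm_star_mul_self]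

theorem ofHom_apply {B : Type v} [CStarAlgebra B] (f : A →⋆ₐ[ℂ] B) (a : A) :
    ofHom f a = ‖f a‖ := rfl

/-- The pointwise supremum of a pointwise bounded family of C*-seminorms. -/
def sup (S : Set (CStarSeminorm A)) (hS : ∀ a, BddAbove ((fun p : CStarSeminorm A => p a) '' S)) :
    CStarSeminorm A := by
  have nn : ∀ a, 0 ≤ sSup ((fun p : CStarSeminorm A => p a) '' S) := fun a =>
    Real.sSup_nonneg (by rintro _ ⟨p, -, rfl⟩; exact p.nonneg a)
  have le : ∀ p ∈ S, ∀ a, p a ≤ sSup ((fun p : CStarSeminorm A => p a) '' S) := fun p hp a =>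
    le_csSup (hS a) ⟨p, hp, rfl⟩
  refine
    { toSeminorm := Seminorm.ofSMulLE (fun a => sSup ((fun p : CStarSeminorm A => p a) '' S))
        ?_ ?_ ?_
      mul_le := ?_
      star_mul_self := ?_ }
  · refine le_antisymm (Real.sSup_le ?_ le_rfl) (nn 0)
    rintro _ ⟨p, -, rfl⟩
    simp
  · intro a b
    refine Real.sSup_le ?_ (add_nonneg (nn a) (nn b))
    rintro _ ⟨p, hp, rfl⟩
    exact (map_add_le_add p.toSeminorm a b).trans (add_le_add (le p hp a) (le p hp b))
  · intro c a
    refine Real.sSup_le ?_ (mul_nonneg (norm_nonneg c) (nn a))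
    rintro _ ⟨p, hp, rfl⟩
    change p (c • a) ≤ _
    rw [map_smul_eq_mul p.toSeminorm c a]
    exact mul_le_mul_of_nonneg_left (le p hp a) (norm_nonneg c)
  · intro a b
    refine Real.sSup_le ?_ (mul_nonneg (nn a) (nn b))
    rintro _ ⟨p, hp, rfl⟩
    exact (p.mul_le a b).trans (mul_le_mul (le p hp a) (le p hp b) (p.nonneg b) (nn a))
  · intro a
    change sSup ((fun p : CStarSeminorm A => p (star a * a)) '' S) =
      sSup ((fun p : CStarSeminorm A => p a) '' S) * sSup ((fun p : CStarSeminorm A => p a) '' S)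
    apply le_antisymm
    · refine Real.sSup_le ?_ (mul_nonneg (nn a) (nn a))
      rintro _ ⟨p, hp, rfl⟩
      change p (star a * a) ≤ _
      rw [p.star_mul_self]
      exact mul_le_mul (le p hp a) (le p hp a) (p.nonneg a) (nn a)
    · have h : sSup ((fun p : CStarSeminorm A => p a) '' S) ≤
          Real.sqrt (sSup ((fun p : CStarSeminorm A => p (star a * a)) '' S)) := by
        refine Real.sSup_le ?_ (Real.sqrt_nonneg _)
        rintro _ ⟨p, hp, rfl⟩
        refine Real.le_sqrt_of_sq_le ?_
        rw [sq, ← p.star_mul_self]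
        exact le p hp _
      calc _ ≤ Real.sqrt _ * Real.sqrt _ := mul_le_mul h h (nn a) (Real.sqrt_nonneg _)
        _ = _ := Real.mul_self_sqrt (nn _)

theorem sup_apply (S : Set (CStarSeminorm A))
    (hS : ∀ a, BddAbove ((fun p : CStarSeminorm A => p a) '' S)) (a : A) :
    sup S hS a = sSup ((fun p : CStarSeminorm A => p a) '' S) := rfl

theorem le_sup {S : Set (CStarSeminorm A)}
    {hS : ∀ a, BddAbove ((fun p : CStarSeminorm A => p a) '' S)} {p : CStarSeminorm A} (hp : p ∈ S)
    (a : A) : p a ≤ sup S hS a := le_csSup (hS a) ⟨p, hp, rfl⟩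

/-- The algebra `A`, regarded as seminormed by the C*-seminorm `p`. -/
def Pre (_p : CStarSeminorm A) : Type u := A

variable (p : CStarSeminorm A)

instance : Ring p.Pre := inferInstanceAs (Ring A)
instance : StarRing p.Pre := inferInstanceAs (StarRing A)
instance : Algebra ℂ p.Pre := inferInstanceAs (Algebra ℂ A)

instance [StarModule ℂ A] : StarModule ℂ p.Pre := inferInstanceAs (StarModule ℂ A)

instance : SeminormedRing p.Pre where
  toRing := inferInstance
  toPseudoMetricSpace :=
    (AddGroupSeminorm.toSeminormedAddGroup
      (p.toSeminorm.toAddGroupSeminorm : AddGroupSeminorm A)).toPseudoMetricSpace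
  norm a := p a
  dist_eq _ _ := rfl
  norm_mul_le := p.mul_le

theorem norm_pre (a : p.Pre) : ‖a‖ = p a := rfl

instance : NormedAlgebra ℂ p.Pre where
  norm_smul_le c a := (map_smul_eq_mul p.toSeminorm c (show A from a)).le

/-- The Hausdorff completion of `A` with respect to the C*-seminorm `p`. -/
def Compl : Type u := UniformSpace.Completion p.Pre

instance : NormedRing p.Compl := inferInstanceAs (NormedRing (UniformSpace.Completion p.Pre))
instance : CompleteSpace p.Compl :=
  inferInstanceAs (CompleteSpace (UniformSpace.Completion p.Pre))

end CStarSeminorm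
end Completion

theorem continuous_hom {C : Type u} {B : Type v} [CStarAlgebra C]
    [CStarAlgebra B] (f : C →⋆ₐ[ℂ] B) : Continuous f :=
  AddMonoidHomClass.continuous_of_bound f 1 fun x => by
    simpa using NonUnitalStarAlgHom.norm_apply_le f x

namespace CStarSeminorm
variable {A : Type u} [Ring A] [StarRing A] [Algebra ℂ A] (p : CStarSeminorm A)

instance : Algebra ℂ p.Compl := (inferInstance : Algebra ℂ (UniformSpace.Completion p.Pre))

instance : NormedAlgebra ℂ p.Compl where
  norm_smul_le :=
    (inferInstance : NormedSpace ℂ (UniformSpace.Completion p.Pre)).norm_smul_le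

/-- The canonical ring homomorphism into the completion. -/
def coeHom : A →+* p.Compl :=
  (UniformSpace.Completion.coeRingHom : p.Pre →+* UniformSpace.Completion p.Pre)

theorem coeHom_smul (c : ℂ) (a : A) : p.coeHom (c • a) = c • p.coeHom a :=
  UniformSpace.Completion.coe_smul (X := p.Pre) c (show p.Pre from a)

theorem norm_coeHom (a : A) : ‖p.coeHom a‖ = p a :=
  UniformSpace.Completion.norm_coe (show p.Pre from a)

theorem denseRange_coeHom : DenseRange p.coeHom :=
  UniformSpace.Completion.denseRange_coe (α := p.Pre)

theorem isometry_star_pre : Isometry (star : p.Pre → p.Pre) :=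
  AddMonoidHomClass.isometry_of_norm (starAddEquiv (R := p.Pre)) fun a => p.star_eq a

instance : Star p.Compl :=
  ⟨UniformSpace.Completion.map (star : p.Pre → p.Pre)⟩

theorem continuous_star_compl : Continuous (star : p.Compl → p.Compl) :=
  UniformSpace.Completion.continuous_map

theorem star_coeHom (a : A) : star (p.coeHom a) = p.coeHom (star a) :=
  UniformSpace.Completion.map_coe p.isometry_star_pre.uniformContinuous (show p.Pre from a)

theorem compl_induction {P : p.Compl → Prop} (x : p.Compl) (hc : IsClosed {x | P x})
    (h : ∀ a, P (p.coeHom a)) : P x :=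
  isClosed_property p.denseRange_coeHom hc h x

instance : StarRing p.Compl where
  star_involutive x := by
    refine p.compl_induction (P := fun x => star (star x) = x) x
      (isClosed_eq (p.continuous_star_compl.comp p.continuous_star_compl) continuous_id) fun a => ?_
    rw [star_coeHom, star_coeHom, star_star]
  star_mul x y := by
    refine p.compl_induction (P := fun x => star (x * y) = star y * star x) x
      (isClosed_eq (p.continuous_star_compl.comp (continuous_mul_const y))
        (continuous_const.mul p.continuous_star_compl)) fun a => ?_
    refine p.compl_induction
      (P := fun y => star (p.coeHom a * y) = star y * star (p.coeHom a)) y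
      (isClosed_eq (p.continuous_star_compl.comp (continuous_const_mul _))
        (p.continuous_star_compl.mul continuous_const)) fun b => ?_
    rw [← map_mul, star_coeHom, star_coeHom, star_coeHom, star_mul, map_mul]
  star_add x y := by
    refine p.compl_induction (P := fun x => star (x + y) = star x + star y) x
      (isClosed_eq (p.continuous_star_compl.comp (continuous_add_const y))
        (p.continuous_star_compl.add continuous_const)) fun a => ?_
    refine p.compl_induction
      (P := fun y => star (p.coeHom a + y) = star (p.coeHom a) + star y) y
      (isClosed_eq (p.continuous_star_compl.comp (continuous_const_add _))
        (continuous_const.add p.continuous_star_compl)) fun b => ?_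
    rw [← map_add, star_coeHom, star_coeHom, star_coeHom, star_add, map_add]

theorem uniformContinuous_aux {B : Type v} [CStarAlgebra B] (f : A →⋆ₐ[ℂ] B)
    (hf : ∀ a, ‖f a‖ ≤ p a) : UniformContinuous (show p.Pre → B from f) :=
  AddMonoidHomClass.uniformContinuous_of_bound
    (show p.Pre →+ B from (f : A →+* B).toAddMonoidHom) 1 fun x => by
      rw [one_mul]; exact hf x

/-- The canonical *-homomorphism from `A` into its completion. -/
def of : A →⋆ₐ[ℂ] p.Compl where
  toRingHom := p.coeHom
  commutes' c := by
    change p.coeHom (algebraMap ℂ A c) = _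
    rw [Algebra.algebraMap_eq_smul_one, coeHom_smul, map_one, Algebra.algebraMap_eq_smul_one]
  map_star' a := (p.star_coeHom a).symm

theorem norm_of (a : A) : ‖p.of a‖ = p a := p.norm_coeHom a

theorem denseRange_of : DenseRange p.of := p.denseRange_coeHom

/-- Extension of a *-homomorphism dominated by `p` to the completion. -/
def lift {p : CStarSeminorm A} {B : Type v} [CStarAlgebra B] (f : A →⋆ₐ[ℂ] B)
    (hf : ∀ a, ‖f a‖ ≤ p a) : p.Compl →⋆ₐ[ℂ] B := by
  let F : p.Compl →+* B := UniformSpace.Completion.extensionHom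
    (show p.Pre →+* B from (f : A →+* B)) (uniformContinuous_aux p f hf).continuous
  have hFc : Continuous F := UniformSpace.Completion.continuous_extension
  have hF : ∀ a, F (p.coeHom a) = f a := fun a =>
    UniformSpace.Completion.extensionHom_coe (α := p.Pre) _
      (uniformContinuous_aux p f hf).continuous a
  exact
    { F with
      commutes' := fun c => by
        change F (algebraMap ℂ p.Compl c) = _
        rw [← (p.of).commutes' c]
        exact (hF _).trans (AlgHomClass.commutes f c)
      map_star' := fun x => by
        refine p.compl_induction (P := fun x => F (star x) = star (F x)) x
          (isClosed_eq (hFc.comp p.continuous_star_compl) hFc.star) fun a => ?_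
        rw [star_coeHom, hF, hF, map_star] }

theorem lift_of {p : CStarSeminorm A} {B : Type v} [CStarAlgebra B] (f : A →⋆ₐ[ℂ] B)
    (hf : ∀ a, ‖f a‖ ≤ p a) (a : A) : lift f hf (p.of a) = f a :=
  UniformSpace.Completion.extensionHom_coe (α := p.Pre) _
      (uniformContinuous_aux p f hf).continuous a

variable [StarModule ℂ A]

/-- The completion with respect to a C*-seminorm is a C*-algebra. -/
instance : CStarAlgebra p.Compl where
  norm_mul_self_le x := by
    refine p.compl_induction (P := fun x => ‖x‖ * ‖x‖ ≤ ‖star x * x‖) x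
      (isClosed_le (continuous_norm.mul continuous_norm)
        (continuous_norm.comp (p.continuous_star_compl.mul continuous_id))) fun a => ?_
    rw [star_coeHom, ← map_mul, norm_coeHom, norm_coeHom, p.star_mul_self]
  star_smul c x := by
    refine p.compl_induction (P := fun x => star (c • x) = star c • star x) x
      (isClosed_eq (p.continuous_star_compl.comp (continuous_const_smul c))
        (((continuous_const_smul (star c)).comp p.continuous_star_compl :))) fun a => ?_
    rw [← coeHom_smul, star_coeHom, star_coeHom, star_smul, coeHom_smul]

variable {p} {B : Type v} [CStarAlgebra B]

theorem hom_ext {f g : p.Compl →⋆ₐ[ℂ] B} (h : ∀ a, f (p.of a) = g (p.of a)) : f = g :=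
  DFunLike.coe_injective <|
    p.denseRange_of.equalizer (continuous_hom f) (continuous_hom g) (funext h)

end CStarSeminorm

/-- A *-homomorphism of C*-algebras with dense range is surjective. -/
theorem surjective_of_denseRange {A : Type u} {B : Type v} [CStarAlgebra A] [CStarAlgebra B]
    (f : A →⋆ₐ[ℂ] B) (hf : DenseRange f) : Function.Surjective f := by
  have key : ∀ a : A, IsSelfAdjoint (f a) → ∃ a', f a' = f a ∧ ‖a'‖ ≤ ‖f a‖ := by
    intro a ha
    set r := ‖f a‖ with hr
    have hr0 : 0 ≤ r := norm_nonneg _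
    set a₀ : A := (realPart a : A) with ha₀
    have hsa : IsSelfAdjoint a₀ := (realPart a).2
    have hfa₀ : f a₀ = f a := by
      rw [ha₀, realPart_apply_coe, ← Complex.coe_smul, map_smul, map_add, map_star, ha.star_eq,
        ← two_smul ℂ, smul_smul]
      norm_num
    let c : ℝ → ℝ := fun t => max (-r) (min t r)
    have hc : Continuous c := by fun_prop
    refine ⟨cfc c a₀, ?_, ?_⟩
    · rw [StarAlgHomClass.map_cfc f c a₀ (by fun_prop) (continuous_hom f), hfa₀]
      conv_rhs => rw [← cfc_id' ℝ (f a)]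
      refine cfc_congr fun t ht => ?_
      have : |t| ≤ r := by
        rcases subsingleton_or_nontrivial B with hB | hB
        · simp at ht
        · simpa using spectrum.norm_le_norm_of_mem ht
      rw [abs_le] at this
      simp [c, this.1, this.2]
    · refine norm_cfc_le hr0 fun t _ => ?_
      rw [Real.norm_eq_abs, abs_le]
      exact ⟨le_max_left _ _, max_le (by linarith) (min_le_right _ _)⟩
  let F : NormedAddGroupHom A B :=
    { toFun := f
      map_add' := map_add f
      bound' := ⟨1, fun x => by simpa using NonUnitalStarAlgHom.norm_apply_le f x⟩ }
  have hyp : ∀ h ∈ F.range, ∃ g, F g = h ∧ ‖g‖ ≤ 2 * ‖h‖ := by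
    rintro h ⟨a, rfl⟩
    change ∃ g, f g = f a ∧ ‖g‖ ≤ 2 * ‖f a‖
    have hre : f (realPart a : A) = (realPart (f a) : B) := by
      simp [realPart_apply_coe, ← Complex.coe_smul, map_star f]
    have him : f (imaginaryPart a : A) = (imaginaryPart (f a) : B) := by
      simp [imaginaryPart_apply_coe, ← Complex.coe_smul, map_star f]
    obtain ⟨x, hx, hxn⟩ := key (realPart a : A) (hre ▸ (realPart (f a)).2)
    obtain ⟨y, hy, hyn⟩ := key (imaginaryPart a : A) (him ▸ (imaginaryPart (f a)).2)
    refine ⟨x + Complex.I • y, ?_, ?_⟩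
    · rw [map_add, map_smul, hx, hy, hre, him, realPart_add_I_smul_imaginaryPart]
    · have h1 : ‖x‖ ≤ ‖f a‖ := hxn.trans (hre ▸ realPart.norm_le (f a))
      have h2 : ‖y‖ ≤ ‖f a‖ := hyn.trans (him ▸ imaginaryPart.norm_le (f a))
      calc ‖x + Complex.I • y‖ ≤ ‖x‖ + ‖Complex.I • y‖ := norm_add_le _ _
        _ ≤ 2 * ‖f a‖ := by rw [norm_smul, Complex.norm_I]; linarith
  intro b
  have hb : b ∈ F.range.topologicalClosure := hf b
  obtain ⟨a, ha, -⟩ := controlled_closure_of_complete two_pos one_pos hyp b hb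
  exact ⟨a, ha⟩

section Tensor

variable {A B : Type u} [CStarAlgebra A] [CStarAlgebra B]

section Spatial

variable {E F : Type u} [NormedAddCommGroup E] [InnerProductSpace ℂ E] [CompleteSpace E]
  [NormedAddCommGroup F] [InnerProductSpace ℂ F] [CompleteSpace F]

/-- The representation `a ⊗ b ↦ π(a) ⊗ ρ(b)` of the algebraic tensor product `A ⊙ B` on the
(algebraic, pre-Hilbert) tensor product of the two Hilbert spaces. -/
def spatialRep (π : A →⋆ₐ[ℂ] (E →L[ℂ] E)) (ρ : B →⋆ₐ[ℂ] (F →L[ℂ] F)) :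
    A ⊗[ℂ] B →ₐ[ℂ] ((E ⊗[ℂ] F) →L[ℂ] (E ⊗[ℂ] F)) :=
  Algebra.TensorProduct.lift
    (AlgHom.ofLinearMap
      { toFun := fun a => TensorProduct.mapL (π a) (ContinuousLinearMap.id ℂ F)
        map_add' := fun a b => by rw [map_add, TensorProduct.mapL_add_left]
        map_smul' := fun c a => by rw [map_smul, TensorProduct.mapL_smul_left]; rfl }
      (by
        change TensorProduct.mapL (π 1) (ContinuousLinearMap.id ℂ F) = 1
        rw [map_one]; exact TensorProduct.mapL_id_id)
      (fun a b => by
        change TensorProduct.mapL (π (a * b)) (ContinuousLinearMap.id ℂ F) =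
          TensorProduct.mapL (π a) (ContinuousLinearMap.id ℂ F) *
            TensorProduct.mapL (π b) (ContinuousLinearMap.id ℂ F)
        rw [map_mul, ← TensorProduct.mapL_mul]; rfl))
    (AlgHom.ofLinearMap
      { toFun := fun b => TensorProduct.mapL (ContinuousLinearMap.id ℂ E) (ρ b)
        map_add' := fun a b => by rw [map_add, TensorProduct.mapL_add_right]
        map_smul' := fun c a => by rw [map_smul, TensorProduct.mapL_smul_right]; rfl }
      (by
        change TensorProduct.mapL (ContinuousLinearMap.id ℂ E) (ρ 1) = 1
        rw [map_one]; exact TensorProduct.mapL_id_id)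
      (fun a b => by
        change TensorProduct.mapL (ContinuousLinearMap.id ℂ E) (ρ (a * b)) =
          TensorProduct.mapL (ContinuousLinearMap.id ℂ E) (ρ a) *
            TensorProduct.mapL (ContinuousLinearMap.id ℂ E) (ρ b)
        rw [map_mul, ← TensorProduct.mapL_mul]; rfl))
    (fun a b => by
      change TensorProduct.mapL (π a) (ContinuousLinearMap.id ℂ F) *
          TensorProduct.mapL (ContinuousLinearMap.id ℂ E) (ρ b) =
        TensorProduct.mapL (ContinuousLinearMap.id ℂ E) (ρ b) *
          TensorProduct.mapL (π a) (ContinuousLinearMap.id ℂ F)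
      rw [← TensorProduct.mapL_mul, ← TensorProduct.mapL_mul]; rfl)

theorem spatialRep_tmul (π : A →⋆ₐ[ℂ] (E →L[ℂ] E)) (ρ : B →⋆ₐ[ℂ] (F →L[ℂ] F)) (a : A) (b : B) :
    spatialRep π ρ (a ⊗ₜ b) = TensorProduct.mapL (π a) (ρ b) := by
  change TensorProduct.mapL (π a) (ContinuousLinearMap.id ℂ F) *
    TensorProduct.mapL (ContinuousLinearMap.id ℂ E) (ρ b) = _
  rw [← TensorProduct.mapL_mul]; rfl

theorem inner_spatialRep (π : A →⋆ₐ[ℂ] (E →L[ℂ] E)) (ρ : B →⋆ₐ[ℂ] (F →L[ℂ] F))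
    (x : A ⊗[ℂ] B) (v w : E ⊗[ℂ] F) :
    inner ℂ (spatialRep π ρ x v) w = inner ℂ v (spatialRep π ρ (star x) w) := by
  induction x using TensorProduct.induction_on with
  | zero => simp
  | add x y hx hy => simp only [map_add, star_add, add_apply, inner_add_left,
      inner_add_right, hx, hy]
  | tmul a b =>
    rw [TensorProduct.star_tmul, spatialRep_tmul, spatialRep_tmul]
    induction v using TensorProduct.induction_on with
    | zero => simp
    | add x y hx hy => simp only [map_add, inner_add_left, hx, hy]
    | tmul e f =>
      induction w using TensorProduct.induction_on with
      | zero => simp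
      | add x y hx hy => simp only [map_add, inner_add_right, hx, hy]
      | tmul e' f' =>
        rw [TensorProduct.mapL_tmul, TensorProduct.mapL_tmul, TensorProduct.inner_tmul,
          TensorProduct.inner_tmul, map_star, map_star, ContinuousLinearMap.star_eq_adjoint,
          ContinuousLinearMap.star_eq_adjoint, ContinuousLinearMap.adjoint_inner_right,
          ContinuousLinearMap.adjoint_inner_right]

theorem norm_sq_spatialRep_le (π : A →⋆ₐ[ℂ] (E →L[ℂ] E)) (ρ : B →⋆ₐ[ℂ] (F →L[ℂ] F))
    (x : A ⊗[ℂ] B) : ‖spatialRep π ρ x‖ * ‖spatialRep π ρ x‖ ≤ ‖spatialRep π ρ (star x * x)‖ := by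
  have h : ‖spatialRep π ρ x‖ ≤ Real.sqrt ‖spatialRep π ρ (star x * x)‖ := by
    refine ContinuousLinearMap.opNorm_le_bound _ (Real.sqrt_nonneg _) fun v => ?_
    refine abs_le_of_sq_le_sq' ?_ (by positivity) |>.2
    rw [mul_pow, Real.sq_sqrt (norm_nonneg (spatialRep π ρ (star x * x))),
      ← inner_self_eq_norm_sq (𝕜 := ℂ), inner_spatialRep,
      ← mul_apply_eq_comp, ← map_mul]
    calc _ ≤ ‖inner ℂ v (spatialRep π ρ (star x * x) v)‖ := RCLike.re_le_norm _
      _ ≤ ‖v‖ * ‖spatialRep π ρ (star x * x) v‖ :=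
        norm_inner_le_norm (𝕜 := ℂ) v (spatialRep π ρ (star x * x) v)
      _ ≤ ‖v‖ * (‖spatialRep π ρ (star x * x)‖ * ‖v‖) := by
        gcongr; exact ContinuousLinearMap.le_opNorm _ _
      _ = _ := by ring
  calc _ ≤ Real.sqrt _ * Real.sqrt _ :=
        mul_le_mul h h (norm_nonneg (spatialRep π ρ x)) (Real.sqrt_nonneg _)
    _ = _ := Real.mul_self_sqrt (norm_nonneg (spatialRep π ρ (star x * x)))

theorem norm_spatialRep_star_le (π : A →⋆ₐ[ℂ] (E →L[ℂ] E)) (ρ : B →⋆ₐ[ℂ] (F →L[ℂ] F))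
    (x : A ⊗[ℂ] B) : ‖spatialRep π ρ (star x)‖ ≤ ‖spatialRep π ρ x‖ := by
  have h1 := norm_sq_spatialRep_le π ρ (star x)
  rw [star_star, map_mul] at h1
  have h2 := norm_mul_le (spatialRep π ρ x) (spatialRep π ρ (star x))
  rcases (norm_nonneg (spatialRep π ρ (star x))).eq_or_lt with h | h
  · rw [← h]; exact norm_nonneg (spatialRep π ρ x)
  · nlinarith

/-- The C*-seminorm `x ↦ ‖(π ⊗ ρ)(x)‖` on the algebraic tensor product. -/
def spatialSeminorm (π : A →⋆ₐ[ℂ] (E →L[ℂ] E)) (ρ : B →⋆ₐ[ℂ] (F →L[ℂ] F)) :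
    CStarSeminorm (A ⊗[ℂ] B) where
  toSeminorm := Seminorm.ofSMulLE (fun x => ‖spatialRep π ρ x‖)
    (by rw [map_zero]; exact ContinuousLinearMap.opNorm_zero)
    (fun x y => by rw [map_add]; exact ContinuousLinearMap.opNorm_add_le _ _)
    (fun c x => by
      rw [map_smul]
      exact ContinuousLinearMap.opNorm_smul_le c (spatialRep π ρ x))
  mul_le x y := by
    change ‖spatialRep π ρ (x * y)‖ ≤ ‖spatialRep π ρ x‖ * ‖spatialRep π ρ y‖
    rw [map_mul]; exact ContinuousLinearMap.opNorm_comp_le _ _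
  star_mul_self x := by
    change ‖spatialRep π ρ (star x * x)‖ = ‖spatialRep π ρ x‖ * ‖spatialRep π ρ x‖
    refine le_antisymm ?_ (norm_sq_spatialRep_le π ρ x)
    rw [map_mul]
    exact (ContinuousLinearMap.opNorm_comp_le _ _).trans
      (mul_le_mul_of_nonneg_right (norm_spatialRep_star_le π ρ x) (norm_nonneg (spatialRep π ρ x)))

theorem spatialSeminorm_apply (π : A →⋆ₐ[ℂ] (E →L[ℂ] E)) (ρ : B →⋆ₐ[ℂ] (F →L[ℂ] F))
    (x : A ⊗[ℂ] B) : spatialSeminorm π ρ x = ‖spatialRep π ρ x‖ := rfl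

end Spatial

variable (A B)

/-- All seminorms `x ↦ ‖(π ⊗ ρ)(x)‖`, for `π`, `ρ` running over the representations of `A`, `B` on
Hilbert spaces. -/
def spatialSeminorms : Set (CStarSeminorm (A ⊗[ℂ] B)) :=
  {p | ∃ (E F : Type u) (_ : NormedAddCommGroup E) (_ : InnerProductSpace ℂ E)
    (_ : CompleteSpace E) (_ : NormedAddCommGroup F) (_ : InnerProductSpace ℂ F)
    (_ : CompleteSpace F) (π : A →⋆ₐ[ℂ] (E →L[ℂ] E)) (ρ : B →⋆ₐ[ℂ] (F →L[ℂ] F)),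
    p = spatialSeminorm π ρ}

theorem bddAbove_spatialSeminorms (x : A ⊗[ℂ] B) :
    BddAbove ((fun p : CStarSeminorm (A ⊗[ℂ] B) => p x) '' spatialSeminorms A B) := by
  induction x using TensorProduct.induction_on with
  | zero =>
    refine ⟨0, ?_⟩
    rintro _ ⟨p, -, rfl⟩
    simp
  | add x y hx hy =>
    obtain ⟨M, hM⟩ := hx
    obtain ⟨N, hN⟩ := hy
    refine ⟨M + N, ?_⟩
    rintro _ ⟨p, hp, rfl⟩
    exact (map_add_le_add p.toSeminorm x y).trans
      (add_le_add (hM ⟨p, hp, rfl⟩) (hN ⟨p, hp, rfl⟩))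
  | tmul a b =>
    refine ⟨‖a‖ * ‖b‖, ?_⟩
    rintro _ ⟨p, ⟨E, F, _, _, _, _, _, _, π, ρ, rfl⟩, rfl⟩
    change ‖spatialRep π ρ (a ⊗ₜ b)‖ ≤ _
    rw [spatialRep_tmul]
    exact (TensorProduct.norm_mapL_le _ _).trans
      (mul_le_mul (NonUnitalStarAlgHom.norm_apply_le π a) (NonUnitalStarAlgHom.norm_apply_le ρ b)
        (norm_nonneg _) (norm_nonneg _))

/-- The spatial (minimal) C*-norm on the algebraic tensor product of two C*-algebras. -/
def minSeminorm : CStarSeminorm (A ⊗[ℂ] B) :=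
  CStarSeminorm.sup (spatialSeminorms A B) (bddAbove_spatialSeminorms A B)

/-- The spatial (minimal) tensor product `A ⊗ B` of two C*-algebras. -/
def MinTensor : Type u := (minSeminorm A B).Compl

instance : CStarAlgebra (MinTensor A B) := inferInstanceAs (CStarAlgebra (minSeminorm A B).Compl)

/-- The canonical *-homomorphism from the algebraic tensor product. -/
def MinTensor.of : A ⊗[ℂ] B →⋆ₐ[ℂ] MinTensor A B := (minSeminorm A B).of

variable {A B}

/-- The elementary tensor `a ⊗ b`. -/
def MinTensor.tmul (a : A) (b : B) : MinTensor A B := MinTensor.of A B (a ⊗ₜ[ℂ] b)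

/-- The *-homomorphism `b ↦ 1 ⊗ b`. -/
def MinTensor.inr : B →⋆ₐ[ℂ] MinTensor A B where
  toAlgHom := ((MinTensor.of A B : A ⊗[ℂ] B →ₐ[ℂ] MinTensor A B)).comp
    Algebra.TensorProduct.includeRight
  map_star' b := by
    change MinTensor.of A B (1 ⊗ₜ star b) = star (MinTensor.of A B (1 ⊗ₜ b))
    rw [← map_star, TensorProduct.star_tmul, star_one]

theorem MinTensor.inr_apply (b : B) : (MinTensor.inr b : MinTensor A B) = MinTensor.tmul 1 b := rfl

theorem MinTensor.tmul_mul (a a' : A) (b b' : B) :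
    MinTensor.tmul a b * MinTensor.tmul a' b' = MinTensor.tmul (a * a') (b * b') := by
  simp only [tmul, ← map_mul, Algebra.TensorProduct.tmul_mul_tmul]

theorem MinTensor.star_tmul (a : A) (b : B) :
    star (MinTensor.tmul a b) = MinTensor.tmul (star a) (star b) := by
  simp only [tmul, ← map_star, TensorProduct.star_tmul]

variable {A' B' C : Type u} [CStarAlgebra A'] [CStarAlgebra B'] [CStarAlgebra C]

theorem MinTensor.hom_ext {f g : MinTensor A B →⋆ₐ[ℂ] C}
    (h : ∀ a b, f (MinTensor.tmul a b) = g (MinTensor.tmul a b)) : f = g := by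
  refine CStarSeminorm.hom_ext (p := minSeminorm A B) fun x => ?_
  change f (MinTensor.of A B x) = g (MinTensor.of A B x)
  induction x using TensorProduct.induction_on with
  | zero => simp
  | add x y hx hy => simp only [map_add, hx, hy]
  | tmul a b => exact h a b

/-- The algebraic tensor product of two *-homomorphisms. -/
def algMap (f : A →⋆ₐ[ℂ] A') (g : B →⋆ₐ[ℂ] B') : A ⊗[ℂ] B →⋆ₐ[ℂ] A' ⊗[ℂ] B' where
  toAlgHom := Algebra.TensorProduct.map (f : A →ₐ[ℂ] A') (g : B →ₐ[ℂ] B')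
  map_star' x := by
    change Algebra.TensorProduct.map (f : A →ₐ[ℂ] A') (g : B →ₐ[ℂ] B') (star x) =
      star (Algebra.TensorProduct.map (f : A →ₐ[ℂ] A') (g : B →ₐ[ℂ] B') x)
    induction x using TensorProduct.induction_on with
    | zero => simp
    | add x y hx hy => simp only [map_add, star_add, hx, hy]
    | tmul a b => simp [TensorProduct.star_tmul, map_star]

theorem minSeminorm_algMap_le (f : A →⋆ₐ[ℂ] A') (g : B →⋆ₐ[ℂ] B') (x : A ⊗[ℂ] B) :
    minSeminorm A' B' (algMap f g x) ≤ minSeminorm A B x := by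
  refine Real.sSup_le ?_ ((minSeminorm A B).nonneg x)
  rintro _ ⟨p, ⟨E, F, _, _, _, _, _, _, π, ρ, rfl⟩, rfl⟩
  have h : spatialSeminorm π ρ (algMap f g x) = spatialSeminorm (π.comp f) (ρ.comp g) x := by
    rw [spatialSeminorm_apply, spatialSeminorm_apply]
    congr 1
    induction x using TensorProduct.induction_on with
    | zero => simp
    | add x y hx hy => simp only [map_add, hx, hy]
    | tmul a b =>
      change spatialRep π ρ (f a ⊗ₜ g b) = _
      rw [spatialRep_tmul, spatialRep_tmul]; rfl
  change spatialSeminorm π ρ (algMap f g x) ≤ _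
  rw [h]
  exact CStarSeminorm.le_sup (hS := bddAbove_spatialSeminorms A B)
    ⟨E, F, _, _, _, _, _, _, π.comp f, ρ.comp g, rfl⟩ x

/-- The tensor product `f ⊗ g : A ⊗ B → A' ⊗ B'` of two *-homomorphisms. -/
def MinTensor.map (f : A →⋆ₐ[ℂ] A') (g : B →⋆ₐ[ℂ] B') : MinTensor A B →⋆ₐ[ℂ] MinTensor A' B' :=
  CStarSeminorm.lift (p := minSeminorm A B) ((MinTensor.of A' B').comp (algMap f g)) fun x => by
    change ‖(minSeminorm A' B').of (algMap f g x)‖ ≤ _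
    rw [CStarSeminorm.norm_of]
    exact minSeminorm_algMap_le f g x

theorem MinTensor.map_tmul (f : A →⋆ₐ[ℂ] A') (g : B →⋆ₐ[ℂ] B') (a : A) (b : B) :
    MinTensor.map f g (MinTensor.tmul a b) = MinTensor.tmul (f a) (g b) :=
  CStarSeminorm.lift_of (p := minSeminorm A B) _ _ _

end Tensor

section MonoidStar

/-- An involutive anti-automorphism of a monoid. -/
class MonoidInvolution (M : Type u) [Monoid M] where
  inv : M → M
  inv_inv : ∀ m, inv (inv m) = m
  inv_mul : ∀ m n, inv (m * n) = inv n * inv m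

instance groupInvolution (Γ : Type u) [Group Γ] : MonoidInvolution Γ where
  inv g := g⁻¹
  inv_inv := _root_.inv_inv
  inv_mul := mul_inv_rev

/-- On words in the letters `x` (coded `(x, false)`) and `x*` (coded `(x, true)`): reverse the word
and exchange `x` and `x*`. -/
instance freeInvolution (X : Type u) : MonoidInvolution (FreeMonoid (X × Bool)) where
  inv w := FreeMonoid.ofList ((w.toList.map fun x => (x.1, !x.2)).reverse)
  inv_inv w := by
    apply FreeMonoid.toList.injective
    simp [Function.comp_def]
  inv_mul v w := by
    apply FreeMonoid.toList.injective
    simp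

variable {M : Type u} [Monoid M] [MonoidInvolution M]

/-- The involution `∑ c_m m ↦ ∑ conj(c_m) m*` of the complex monoid algebra. -/
instance : Star (MonoidAlgebra ℂ M) where
  star f := MonoidAlgebra.liftNC
    ((MonoidAlgebra.singleOneRingHom.comp (starRingEnd ℂ) : ℂ →+* MonoidAlgebra ℂ M) :
      ℂ →+ MonoidAlgebra ℂ M)
    (fun m => MonoidAlgebra.single (MonoidInvolution.inv m) 1) f

theorem star_single (m : M) (c : ℂ) :
    star (MonoidAlgebra.single m c : MonoidAlgebra ℂ M) =
      MonoidAlgebra.single (MonoidInvolution.inv m) (starRingEnd ℂ c) := by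
  change MonoidAlgebra.liftNC _ _ _ = _
  rw [MonoidAlgebra.liftNC_single]
  simp

theorem star_add_aux (f g : MonoidAlgebra ℂ M) : star (f + g) = star f + star g :=
  map_add (MonoidAlgebra.liftNC _ _) f g

theorem star_zero_aux : star (0 : MonoidAlgebra ℂ M) = 0 :=
  map_zero (MonoidAlgebra.liftNC _ _)

instance : StarRing (MonoidAlgebra ℂ M) where
  star_involutive f := by
    induction f using MonoidAlgebra.induction_linear with
    | zero => rw [star_zero_aux, star_zero_aux]
    | add f g hf hg => rw [star_add_aux, star_add_aux, hf, hg]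
    | single m c => rw [star_single, star_single, MonoidInvolution.inv_inv, Complex.conj_conj]
  star_mul f g := by
    induction f using MonoidAlgebra.induction_linear with
    | zero => rw [zero_mul, star_zero_aux, mul_zero]
    | add f f' hf hf' => rw [add_mul, star_add_aux, star_add_aux, hf, hf', mul_add]
    | single m c =>
      induction g using MonoidAlgebra.induction_linear with
      | zero => rw [mul_zero, star_zero_aux, zero_mul]
      | add f f' hf hf' => rw [mul_add, star_add_aux, star_add_aux, hf, hf', add_mul]
      | single n d =>
        rw [MonoidAlgebra.single_mul_single, star_single, star_single, star_single,
          MonoidAlgebra.single_mul_single, MonoidInvolution.inv_mul, map_mul, mul_comm]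
  star_add := star_add_aux

instance : StarModule ℂ (MonoidAlgebra ℂ M) where
  star_smul c f := by
    induction f using MonoidAlgebra.induction_linear with
    | zero => rw [smul_zero, star_zero, smul_zero]
    | add f g hf hg => rw [smul_add, star_add, star_add, smul_add, hf, hg]
    | single m d =>
      rw [MonoidAlgebra.smul_single, star_single, star_single, MonoidAlgebra.smul_single]
      simp

/-- The *-homomorphism on the monoid algebra extending a multiplicative map compatible with the
involutions. -/
def monoidLift {B : Type v} [CStarAlgebra B] (φ : M →* B)
    (h : ∀ m, φ (MonoidInvolution.inv m) = star (φ m)) : MonoidAlgebra ℂ M →⋆ₐ[ℂ] B where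
  toAlgHom := MonoidAlgebra.lift ℂ B M φ
  map_star' f := by
    change MonoidAlgebra.lift ℂ B M φ (star f) = star (MonoidAlgebra.lift ℂ B M φ f)
    induction f using MonoidAlgebra.induction_linear with
    | zero => simp
    | add f g hf hg => rw [star_add, map_add, map_add, star_add, hf, hg]
    | single m d =>
      rw [star_single, MonoidAlgebra.lift_single, MonoidAlgebra.lift_single, h, star_smul]; rfl

theorem monoidLift_single {B : Type v} [CStarAlgebra B] (φ : M →* B)
    (h : ∀ m, φ (MonoidInvolution.inv m) = star (φ m)) (m : M) :
    monoidLift φ h (MonoidAlgebra.single m 1) = φ m :=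
  (MonoidAlgebra.lift_single φ m 1).trans (one_smul _ _)

/-- Boundedness of a family of C*-seminorms on a monoid algebra, from boundedness by `1` on the
monoid. -/
theorem bddAbove_of_le_one (S : Set (CStarSeminorm (MonoidAlgebra ℂ M)))
    (h : ∀ p ∈ S, ∀ m, p (MonoidAlgebra.single m 1) ≤ 1) (f : MonoidAlgebra ℂ M) :
    BddAbove ((fun p : CStarSeminorm (MonoidAlgebra ℂ M) => p f) '' S) := by
  induction f using MonoidAlgebra.induction_linear with
  | zero =>
    refine ⟨0, ?_⟩
    rintro _ ⟨p, -, rfl⟩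
    simp
  | add x y hx hy =>
    obtain ⟨K, hK⟩ := hx
    obtain ⟨N, hN⟩ := hy
    refine ⟨K + N, ?_⟩
    rintro _ ⟨p, hp, rfl⟩
    exact (map_add_le_add p.toSeminorm x y).trans
      (add_le_add (hK ⟨p, hp, rfl⟩) (hN ⟨p, hp, rfl⟩))
  | single m c =>
    refine ⟨‖c‖, ?_⟩
    rintro _ ⟨p, hp, rfl⟩
    have : (MonoidAlgebra.single m c : MonoidAlgebra ℂ M) = c • MonoidAlgebra.single m 1 := by
      rw [MonoidAlgebra.smul_single, smul_eq_mul, mul_one]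
    change p (MonoidAlgebra.single m c) ≤ _
    rw [this, map_smul_eq_mul p.toSeminorm]
    exact mul_le_of_le_one_right (norm_nonneg c) (h p hp m)

end MonoidStar

section GroupCStar

variable (Γ : Type u) [Group Γ]

/-- The largest C*-seminorm on the group *-algebra. -/
def groupSeminorm : CStarSeminorm (MonoidAlgebra ℂ Γ) :=
  CStarSeminorm.sup Set.univ (bddAbove_of_le_one _ fun p _ g => by
    have h1 := p.star_mul_self (MonoidAlgebra.single g 1)
    rw [star_single, MonoidAlgebra.single_mul_single] at h1
    simp only [map_one, mul_one] at h1
    have h2 : (MonoidAlgebra.single (MonoidInvolution.inv g * g) (1 : ℂ)) = 1 := by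
      change (MonoidAlgebra.single (g⁻¹ * g) (1 : ℂ)) = 1
      rw [inv_mul_cancel]; rfl
    rw [h2] at h1
    nlinarith [p.one_le, p.nonneg (MonoidAlgebra.single g 1)])

/-- The full group C*-algebra `C*(Γ)` of a discrete group: the completion of the group *-algebra in
its largest C*-seminorm. -/
def GroupCStar : Type u := (groupSeminorm Γ).Compl

instance : CStarAlgebra (GroupCStar Γ) := inferInstanceAs (CStarAlgebra (groupSeminorm Γ).Compl)

variable {Γ}

namespace GroupCStar

/-- The canonical *-homomorphism from the group *-algebra. -/
def of : MonoidAlgebra ℂ Γ →⋆ₐ[ℂ] GroupCStar Γ := (groupSeminorm Γ).of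

/-- The canonical unitary of `C*(Γ)` associated with a group element. -/
def δ (g : Γ) : GroupCStar Γ := of (MonoidAlgebra.single g 1)

theorem δ_one : δ (1 : Γ) = 1 := map_one (of (Γ := Γ))

theorem δ_mul (g h : Γ) : δ (g * h) = δ g * δ h := by
  have := map_mul (of (Γ := Γ)) (MonoidAlgebra.single g 1) (MonoidAlgebra.single h 1)
  rw [MonoidAlgebra.single_mul_single, mul_one] at this
  exact this

theorem star_δ (g : Γ) : star (δ g) = δ g⁻¹ := by
  have := map_star (of (Γ := Γ)) (MonoidAlgebra.single g 1)
  rw [star_single, map_one] at this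
  exact this.symm

theorem dense_span : Dense (Submodule.span ℂ (Set.range (δ : Γ → GroupCStar Γ)) :
    Set (GroupCStar Γ)) := by
  refine (groupSeminorm Γ).denseRange_of.mono ?_
  rintro _ ⟨f, rfl⟩
  change of f ∈ Submodule.span ℂ (Set.range (δ : Γ → GroupCStar Γ))
  induction f using MonoidAlgebra.induction_linear with
  | zero => rw [map_zero]; exact Submodule.zero_mem _
  | add f g hf hg => rw [map_add]; exact Submodule.add_mem _ hf hg
  | single m c =>
    have : (MonoidAlgebra.single m c : MonoidAlgebra ℂ Γ) = c • MonoidAlgebra.single m 1 := by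
      rw [MonoidAlgebra.smul_single, smul_eq_mul, mul_one]
    rw [this, map_smul]
    exact Submodule.smul_mem _ _ (Submodule.subset_span ⟨m, rfl⟩)

variable {B : Type u} [CStarAlgebra B]

theorem hom_ext {f g : GroupCStar Γ →⋆ₐ[ℂ] B} (h : ∀ x, f (δ x) = g (δ x)) : f = g := by
  refine DFunLike.coe_injective (Continuous.ext_on dense_span (continuous_hom f)
    (continuous_hom g) ?_)
  intro x hx
  induction hx using Submodule.span_induction with
  | mem x hx => obtain ⟨x, rfl⟩ := hx; exact h x
  | zero => rw [map_zero, map_zero]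
  | add x y _ _ hx hy => rw [map_add, map_add, hx, hy]
  | smul c x _ hx => rw [map_smul, map_smul, hx]

/-- The universal property: a unitary representation of `Γ` in a C*-algebra extends to `C*(Γ)`. -/
def lift (φ : Γ →* B) (h : ∀ g, φ g⁻¹ = star (φ g)) : GroupCStar Γ →⋆ₐ[ℂ] B :=
  CStarSeminorm.lift (p := groupSeminorm Γ) (monoidLift φ h) fun f =>
    CStarSeminorm.le_sup (S := Set.univ) (p := CStarSeminorm.ofHom (monoidLift φ h))
      (Set.mem_univ _) f

theorem lift_δ (φ : Γ →* B) (h : ∀ g, φ g⁻¹ = star (φ g)) (g : Γ) : lift φ h (δ g) = φ g :=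
  (CStarSeminorm.lift_of (p := groupSeminorm Γ) _ _ _).trans (monoidLift_single φ h g)

/-- Functoriality: a group homomorphism `φ : Γ → Δ` induces `C*(Γ) → C*(Δ)`, `g ↦ φ(g)`. -/
def map {Δ : Type u} [Group Δ] (φ : Γ →* Δ) : GroupCStar Γ →⋆ₐ[ℂ] GroupCStar Δ :=
  lift { toFun := fun g => δ (φ g)
         map_one' := by rw [map_one, δ_one]
         map_mul' := fun g h => by rw [map_mul, δ_mul] }
    fun g => by
      change δ (φ g⁻¹) = star (δ (φ g))
      rw [star_δ, map_inv]

theorem map_δ {Δ : Type u} [Group Δ] (φ : Γ →* Δ) (g : Γ) : map φ (δ g) = δ (φ g) :=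
  lift_δ _ _ g

/-- The comultiplication `g ↦ g ⊗ g` of `C*(Γ)`. -/
def comul : GroupCStar Γ →⋆ₐ[ℂ] MinTensor (GroupCStar Γ) (GroupCStar Γ) :=
  lift { toFun := fun g => MinTensor.tmul (δ g) (δ g)
         map_one' := by
          rw [δ_one]; exact map_one (MinTensor.of _ _)
         map_mul' := fun g h => by rw [MinTensor.tmul_mul, δ_mul] }
    fun g => by
      change MinTensor.tmul (δ g⁻¹) (δ g⁻¹) = star (MinTensor.tmul (δ g) (δ g))
      rw [MinTensor.star_tmul, star_δ]

theorem comul_δ (g : Γ) : comul (δ g) = MinTensor.tmul (δ g) (δ g) := lift_δ _ _ g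

end GroupCStar
end GroupCStar

section Biunitary

variable {n : ℕ} {A : Type u} [Ring A] [StarRing A]

/-- A square matrix is biunitary if it is unitary and its transpose is unitary. -/
def IsBiunitary (w : Matrix (Fin n) (Fin n) A) : Prop :=
  w ∈ unitary (Matrix (Fin n) (Fin n) A) ∧ w.transpose ∈ unitary (Matrix (Fin n) (Fin n) A)

/-- The defining relations of a biunitary matrix, each brought into the form `x = 0`. -/
def biunitaryRel (w : Matrix (Fin n) (Fin n) A) : Set A :=
  {x | ∃ i j, x = (star w * w - 1) i j ∨ x = (w * star w - 1) i j ∨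
    x = (star w.transpose * w.transpose - 1) i j ∨ x = (w.transpose * star w.transpose - 1) i j}

variable {B : Type v} [Ring B] [StarRing B] [Algebra ℂ A] [Algebra ℂ B]

theorem map_star_mul_sub (f : A →⋆ₐ[ℂ] B) (w w' : Matrix (Fin n) (Fin n) A) :
    (w * w' - 1).map f = w.map f * w'.map f - 1 := by
  ext i j
  simp [Matrix.mul_apply, Matrix.one_apply, map_sum, apply_ite f]

theorem map_star_matrix (f : A →⋆ₐ[ℂ] B) (w : Matrix (Fin n) (Fin n) A) :
    (star w).map f = star (w.map f) := by
  ext i j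
  simp [Matrix.star_apply, map_star f]

theorem isBiunitary_map_iff (f : A →⋆ₐ[ℂ] B) (w : Matrix (Fin n) (Fin n) A) :
    IsBiunitary (w.map f) ↔ ∀ x ∈ biunitaryRel w, f x = 0 := by
  have key : ∀ a b : Matrix (Fin n) (Fin n) A,
      a.map f * b.map f = 1 ↔ ∀ i j, f ((a * b - 1) i j) = 0 := by
    intro a b
    rw [← sub_eq_zero, ← map_star_mul_sub f, ← Matrix.ext_iff]
    rfl
  have hT : (w.map f).transpose = w.transpose.map f := rfl
  rw [IsBiunitary, Unitary.mem_iff, Unitary.mem_iff, hT, ← map_star_matrix, ← map_star_matrix,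
    key, key, key, key]
  constructor
  · rintro ⟨⟨h1, h2⟩, h3, h4⟩ x ⟨i, j, rfl | rfl | rfl | rfl⟩
    exacts [h1 i j, h2 i j, h3 i j, h4 i j]
  · intro h
    exact ⟨⟨fun i j => h _ ⟨i, j, .inl rfl⟩, fun i j => h _ ⟨i, j, .inr (.inl rfl)⟩⟩,
      fun i j => h _ ⟨i, j, .inr (.inr (.inl rfl))⟩, fun i j => h _ ⟨i, j, .inr (.inr (.inr rfl))⟩⟩

theorem IsBiunitary.map {w : Matrix (Fin n) (Fin n) A} (hw : IsBiunitary w) (f : A →⋆ₐ[ℂ] B) :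
    IsBiunitary (w.map f) := by
  rw [isBiunitary_map_iff]
  obtain ⟨⟨h1, h2⟩, h3, h4⟩ := hw
  rintro x ⟨i, j, rfl | rfl | rfl | rfl⟩
  · rw [h1]; simp
  · rw [h2]; simp
  · rw [h3]; simp
  · rw [h4]; simp

theorem IsBiunitary.norm_le {B : Type v} [CStarAlgebra B] {w : Matrix (Fin n) (Fin n) B}
    (hw : IsBiunitary w) (i j : Fin n) : ‖w i j‖ ≤ 1 := by
  let _ := CStarAlgebra.spectralOrder B
  let _ := CStarAlgebra.spectralOrderedRing B
  have h1 : ∑ k, star (w k j) * w k j = 1 := by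
    have := congrFun (congrFun hw.1.1 j) j
    simpa [Matrix.mul_apply, Matrix.star_apply] using this
  have h2 : star (w i j) * w i j ≤ 1 := by
    rw [← h1]
    exact Finset.single_le_sum (f := fun k => star (w k j) * w k j)
      (fun k _ => star_mul_self_nonneg (w k j)) (Finset.mem_univ i)
  have h3 := CStarAlgebra.norm_le_norm_of_nonneg_of_le (star_mul_self_nonneg (w i j)) h2
  rw [CStarRing.norm_star_mul_self] at h3
  have h4 : ‖(1 : B)‖ ≤ 1 := by
    have := CStarRing.norm_star_mul_self (x := (1 : B))
    rw [star_one, one_mul] at this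
    nlinarith [norm_nonneg (1 : B)]
  nlinarith [norm_nonneg (w i j)]

end Biunitary

section UPlus

/-- The free complex *-algebra on the symbols `u_ij`, `1 ≤ i, j ≤ n`. -/
abbrev FreeStarAlg (n : ℕ) : Type u :=
  MonoidAlgebra ℂ (FreeMonoid (ULift.{u} (Fin n × Fin n) × Bool))

/-- The matrix of generators of the free *-algebra. -/
def freeGen (n : ℕ) : Matrix (Fin n) (Fin n) (FreeStarAlg.{u} n) :=
  fun i j => MonoidAlgebra.single (FreeMonoid.of (ULift.up (i, j), false)) 1

/-- The C*-seminorms for which the matrix of generators becomes biunitary. -/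
def biunitarySeminorms (n : ℕ) : Set (CStarSeminorm (FreeStarAlg.{u} n)) :=
  {p | ∀ x ∈ biunitaryRel (freeGen n), p x = 0}

theorem isBiunitary_of_mem {n : ℕ} {p : CStarSeminorm (FreeStarAlg.{u} n)}
    (hp : p ∈ biunitarySeminorms n) : IsBiunitary ((freeGen n).map p.of) := by
  rw [isBiunitary_map_iff]
  intro x hx
  rw [← norm_eq_zero, CStarSeminorm.norm_of]
  exact hp x hx

theorem freeGen_star {n : ℕ} (i j : Fin n) : star (freeGen.{u} n i j) =
    MonoidAlgebra.single (FreeMonoid.of (ULift.up (i, j), true)) 1 := by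
  rw [freeGen, star_single, map_one]; rfl

theorem bddAbove_biunitary (n : ℕ) (x : FreeStarAlg.{u} n) :
    BddAbove ((fun p : CStarSeminorm (FreeStarAlg.{u} n) => p x) '' biunitarySeminorms n) := by
  refine bddAbove_of_le_one _ (fun p hp w => ?_) x
  have h0 : ∀ i j, p (freeGen n i j) ≤ 1 := fun i j => by
    rw [← CStarSeminorm.norm_of]
    exact (isBiunitary_of_mem hp).norm_le i j
  induction w using FreeMonoid.inductionOn' with
  | one => exact p.one_le
  | of_mul y w hw =>
    have : (MonoidAlgebra.single (FreeMonoid.of y * w) 1 : FreeStarAlg.{u} n) =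
        MonoidAlgebra.single (FreeMonoid.of y) 1 * MonoidAlgebra.single w 1 := by
      rw [MonoidAlgebra.single_mul_single, mul_one]
    rw [this]
    have h1 : p (MonoidAlgebra.single (FreeMonoid.of y) 1) ≤ 1 := by
      obtain ⟨⟨i, j⟩, b⟩ := y
      cases b
      · exact h0 i j
      · rw [← freeGen_star, p.star_eq]; exact h0 i j
    exact (p.mul_le _ _).trans (mul_le_one₀ h1 (p.nonneg _) hw)

/-- The universal C*-seminorm on the free *-algebra making the generators biunitary. -/
def uPlusSeminorm (n : ℕ) : CStarSeminorm (FreeStarAlg.{u} n) :=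
  CStarSeminorm.sup (biunitarySeminorms n) (bddAbove_biunitary n)

/-- The algebra `C(U_n⁺)`: the universal C*-algebra generated by the entries of an `n × n` biunitary
matrix. -/
def UPlus (n : ℕ) : Type u := (uPlusSeminorm.{u} n).Compl

instance (n : ℕ) : CStarAlgebra (UPlus.{u} n) :=
  inferInstanceAs (CStarAlgebra (uPlusSeminorm.{u} n).Compl)

namespace UPlus

variable {n : ℕ}

/-- The canonical *-homomorphism from the free *-algebra. -/
def of : FreeStarAlg.{u} n →⋆ₐ[ℂ] UPlus.{u} n := (uPlusSeminorm n).of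

/-- The fundamental corepresentation of `U_n⁺`. -/
def gen (n : ℕ) : Matrix (Fin n) (Fin n) (UPlus.{u} n) := (freeGen n).map of

theorem isBiunitary_gen : IsBiunitary (gen.{u} n) := by
  refine isBiunitary_of_mem (p := uPlusSeminorm n) fun x hx => ?_
  refine le_antisymm (Real.sSup_le ?_ le_rfl) ((uPlusSeminorm n).nonneg x)
  rintro _ ⟨p, hp, rfl⟩
  exact (hp x hx).le

/-- A closed *-subalgebra containing all `u_ij` is everything. -/
theorem mem_of_gen_mem (S : StarSubalgebra ℂ (UPlus.{u} n)) (hS : IsClosed (S : Set (UPlus.{u} n)))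
    (h : ∀ i j, gen n i j ∈ S) (x : UPlus.{u} n) : x ∈ S := by
  refine (uPlusSeminorm n).compl_induction (P := fun x => x ∈ S) x hS fun f => ?_
  change of f ∈ S
  induction f using MonoidAlgebra.induction_linear with
  | zero => rw [map_zero]; exact zero_mem S
  | add f g hf hg => rw [map_add]; exact add_mem hf hg
  | single w c =>
    have : (MonoidAlgebra.single w c : FreeStarAlg.{u} n) = c • MonoidAlgebra.single w 1 := by
      rw [MonoidAlgebra.smul_single, smul_eq_mul, mul_one]
    rw [this, map_smul]
    refine SMulMemClass.smul_mem c ?_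
    clear this
    induction w using FreeMonoid.inductionOn' with
    | one => exact (map_one (of (n := n))).symm ▸ one_mem S
    | of_mul y w hw =>
      have : (MonoidAlgebra.single (FreeMonoid.of y * w) 1 : FreeStarAlg.{u} n) =
          MonoidAlgebra.single (FreeMonoid.of y) 1 * MonoidAlgebra.single w 1 := by
        rw [MonoidAlgebra.single_mul_single, mul_one]
      rw [this, map_mul]
      refine mul_mem ?_ hw
      obtain ⟨⟨i, j⟩, b⟩ := y
      cases b
      · exact h i j
      · rw [← freeGen_star, map_star]; exact star_mem (h i j)

variable {B : Type u} [CStarAlgebra B]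

theorem hom_ext {f g : UPlus.{u} n →⋆ₐ[ℂ] B} (h : ∀ i j, f (gen n i j) = g (gen n i j)) :
    f = g := by
  ext x
  exact mem_of_gen_mem (StarAlgHom.equalizer f g)
    (isClosed_eq (continuous_hom f) (continuous_hom g)) h x

theorem surjective_of_gen {A : Type u} [CStarAlgebra A] (f : A →⋆ₐ[ℂ] UPlus.{u} n)
    (h : ∀ i j, gen n i j ∈ f.range) : Function.Surjective f := by
  refine surjective_of_denseRange f fun x => ?_
  exact mem_of_gen_mem f.range.topologicalClosure (StarSubalgebra.isClosed_topologicalClosure _)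
    (fun i j => StarSubalgebra.le_topologicalClosure _ (h i j)) x

/-- The *-homomorphism on the free *-algebra determined by a matrix. -/
def freeLift (w : Matrix (Fin n) (Fin n) B) : FreeStarAlg.{u} n →⋆ₐ[ℂ] B :=
  monoidLift (FreeMonoid.lift fun y : ULift.{u} (Fin n × Fin n) × Bool =>
    if y.2 then star (w y.1.down.1 y.1.down.2) else w y.1.down.1 y.1.down.2) fun m => by
      induction m using FreeMonoid.inductionOn' with
      | one =>
        change FreeMonoid.lift _ (1 : FreeMonoid _) = _
        rw [map_one, star_one]
      | of_mul y m hm =>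
        rw [MonoidInvolution.inv_mul, map_mul, map_mul, star_mul, hm]
        congr 1
        change FreeMonoid.lift _ (FreeMonoid.of (y.1, !y.2)) = _
        rw [FreeMonoid.lift_eval_of, FreeMonoid.lift_eval_of]
        cases y.2 <;> simp

theorem freeLift_gen (w : Matrix (Fin n) (Fin n) B) (i j : Fin n) :
    freeLift w (freeGen n i j) = w i j := by
  refine (monoidLift_single _ _ _).trans ?_
  rw [FreeMonoid.lift_eval_of]; rfl

/-- The universal property of `C(U_n⁺)`: the *-homomorphism `u_ij ↦ w_ij`, for a biunitary `w`. -/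
def lift (w : Matrix (Fin n) (Fin n) B) (hw : IsBiunitary w) : UPlus.{u} n →⋆ₐ[ℂ] B :=
  CStarSeminorm.lift (p := uPlusSeminorm n) (freeLift w) fun x =>
    CStarSeminorm.le_sup (S := biunitarySeminorms n) (p := CStarSeminorm.ofHom (freeLift w))
      (fun x hx => by
        rw [CStarSeminorm.ofHom_apply, norm_eq_zero]
        refine (isBiunitary_map_iff (freeLift w) (freeGen n)).1 ?_ x hx
        have : (freeGen n).map (freeLift w) = w := by ext i j; exact freeLift_gen w i j
        rwa [this]) x

theorem lift_gen (w : Matrix (Fin n) (Fin n) B) (hw : IsBiunitary w) (i j : Fin n) :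
    lift w hw (gen n i j) = w i j :=
  (CStarSeminorm.lift_of (p := uPlusSeminorm n) _ _ _).trans (freeLift_gen w i j)

end UPlus
end UPlus

section Legs

variable {A B : Type u} [CStarAlgebra A] [CStarAlgebra B]

/-- The *-homomorphism `a ↦ a ⊗ 1`. -/
def MinTensor.inl : A →⋆ₐ[ℂ] MinTensor A B where
  toAlgHom := ((MinTensor.of A B : A ⊗[ℂ] B →ₐ[ℂ] MinTensor A B)).comp
    Algebra.TensorProduct.includeLeft
  map_star' b := by
    change MinTensor.of A B (star b ⊗ₜ 1) = star (MinTensor.of A B (b ⊗ₜ 1))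
    rw [← map_star, TensorProduct.star_tmul, star_one]

theorem MinTensor.inl_mul_inr (a : A) (b : B) :
    (MinTensor.inl a : MinTensor A B) * MinTensor.inr b = MinTensor.tmul a b := by
  change MinTensor.tmul a 1 * MinTensor.tmul 1 b = _
  rw [MinTensor.tmul_mul, mul_one, one_mul]

theorem MinTensor.inr_mul_inl (a : A) (b : B) :
    (MinTensor.inr b : MinTensor A B) * MinTensor.inl a = MinTensor.tmul a b := by
  change MinTensor.tmul 1 b * MinTensor.tmul a 1 = _
  rw [MinTensor.tmul_mul, mul_one, one_mul]

variable {n : ℕ}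

/-- The matrix `(∑_s w_is ⊗ w_sj)_ij`. -/
def tensorSquare (w : Matrix (Fin n) (Fin n) A) : Matrix (Fin n) (Fin n) (MinTensor A A) :=
  fun i j => ∑ s, MinTensor.tmul (w i s) (w s j)

theorem tensorSquare_eq (w : Matrix (Fin n) (Fin n) A) :
    tensorSquare w = w.map MinTensor.inl * w.map MinTensor.inr := by
  ext i j
  simp [tensorSquare, Matrix.mul_apply, MinTensor.inl_mul_inr]

theorem isBiunitary_tensorSquare {w : Matrix (Fin n) (Fin n) A} (hw : IsBiunitary w) :
    IsBiunitary (tensorSquare w) := by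
  have hl := hw.map (MinTensor.inl : A →⋆ₐ[ℂ] MinTensor A A)
  have hr := hw.map (MinTensor.inr : A →⋆ₐ[ℂ] MinTensor A A)
  rw [tensorSquare_eq]
  refine ⟨mul_mem hl.1 hr.1, ?_⟩
  have : (w.map (MinTensor.inl : A →⋆ₐ[ℂ] MinTensor A A) *
      w.map (MinTensor.inr : A →⋆ₐ[ℂ] MinTensor A A)).transpose =
      (w.map (MinTensor.inr : A →⋆ₐ[ℂ] MinTensor A A)).transpose *
        (w.map (MinTensor.inl : A →⋆ₐ[ℂ] MinTensor A A)).transpose := by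
    ext i j
    simp [Matrix.mul_apply, MinTensor.inl_mul_inr, MinTensor.inr_mul_inl]
  rw [this]
  exact mul_mem hr.2 hl.2

theorem map_tensorSquare (f : A →⋆ₐ[ℂ] B) (w : Matrix (Fin n) (Fin n) A) (i j : Fin n) :
    MinTensor.map f f (tensorSquare w i j) = tensorSquare (w.map f) i j := by
  simp [tensorSquare, map_sum, MinTensor.map_tmul]

end Legs

/-- The comultiplication `Δ(u_ij) = ∑_s u_is ⊗ u_sj` of `C(U_n⁺)`. -/
def UPlus.comul (n : ℕ) : UPlus.{u} n →⋆ₐ[ℂ] MinTensor (UPlus.{u} n) (UPlus.{u} n) :=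
  UPlus.lift (tensorSquare (UPlus.gen n)) (isBiunitary_tensorSquare UPlus.isBiunitary_gen)

theorem UPlus.comul_gen {n : ℕ} (i j : Fin n) :
    UPlus.comul.{u} n (UPlus.gen n i j) = tensorSquare (UPlus.gen n) i j :=
  UPlus.lift_gen _ _ i j

/-- A quantum subgroup `G ⊂ U_n⁺`: a C*-algebra `C(G)` with a comultiplication, and a surjective
morphism `C(U_n⁺) → C(G)` intertwining the comultiplications. (Coassociativity and cobisimplifiability
pass from `C(U_n⁺)` to `C(G)` along this surjection.) -/
structure QuantumSubgroup (n : ℕ) where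
  /-- the algebra `C(G)` -/
  carrier : Type u
  [cstar : CStarAlgebra carrier]
  /-- the comultiplication of `C(G)` -/
  comul : carrier →⋆ₐ[ℂ] MinTensor carrier carrier
  /-- the restriction morphism `C(U_n⁺) → C(G)` -/
  proj : UPlus.{u} n →⋆ₐ[ℂ] carrier
  surjective : Function.Surjective proj
  comul_proj : ∀ x, comul (proj x) = MinTensor.map proj proj (UPlus.comul n x)

attribute [instance] QuantumSubgroup.cstar

/-- Construction of a quantum subgroup of `U_n⁺` from its fundamental corepresentation. -/
def QuantumSubgroup.ofMatrix {n : ℕ} {A : Type u} [CStarAlgebra A]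
    (Δ : A →⋆ₐ[ℂ] MinTensor A A) (w : Matrix (Fin n) (Fin n) A) (hw : IsBiunitary w)
    (hs : Function.Surjective (UPlus.lift w hw))
    (hΔ : ∀ i j, Δ (w i j) = tensorSquare w i j) : QuantumSubgroup.{u} n where
  carrier := A
  comul := Δ
  proj := UPlus.lift w hw
  surjective := hs
  comul_proj := by
    have : Δ.comp (UPlus.lift w hw) =
        (MinTensor.map (UPlus.lift w hw) (UPlus.lift w hw)).comp (UPlus.comul n) := by
      refine UPlus.hom_ext fun i j => ?_
      change Δ (UPlus.lift w hw (UPlus.gen n i j)) =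
        MinTensor.map (UPlus.lift w hw) (UPlus.lift w hw) (UPlus.comul n (UPlus.gen n i j))
      rw [UPlus.comul_gen, map_tensorSquare, UPlus.lift_gen, hΔ]
      congr 1
      ext i j
      exact (UPlus.lift_gen w hw i j).symm
    exact fun x => DFunLike.congr_fun this x

section Block

variable {n k : ℕ} {A : Type u} [CStarAlgebra A]

/-- The index bijection `{1,…,k} ⊔ {1,…,n-k} ≃ {1,…,n}`. -/
def blockEquiv (hk : k ≤ n) : Fin k ⊕ Fin (n - k) ≃ Fin n :=
  finSumFinEquiv.trans (finCongr (Nat.add_sub_of_le hk))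

/-- The block matrix `diag(v, 1_{n-k})`. -/
def blockDiag (hk : k ≤ n) (v : Matrix (Fin k) (Fin k) A) : Matrix (Fin n) (Fin n) A :=
  Matrix.reindex (blockEquiv hk) (blockEquiv hk) (Matrix.fromBlocks v 0 0 1)

theorem blockDiag_mul (hk : k ≤ n) (v w : Matrix (Fin k) (Fin k) A) :
    blockDiag hk v * blockDiag hk w = blockDiag hk (v * w) := by
  simp [blockDiag, Matrix.submatrix_mul_equiv, Matrix.fromBlocks_multiply]

theorem blockDiag_one (hk : k ≤ n) : blockDiag hk (1 : Matrix (Fin k) (Fin k) A) = 1 := by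
  simp [blockDiag]

theorem blockDiag_star (hk : k ≤ n) (v : Matrix (Fin k) (Fin k) A) :
    star (blockDiag hk v) = blockDiag hk (star v) := by
  simp [blockDiag, Matrix.star_eq_conjTranspose, Matrix.fromBlocks_conjTranspose]

theorem blockDiag_transpose (hk : k ≤ n) (v : Matrix (Fin k) (Fin k) A) :
    (blockDiag hk v).transpose = blockDiag hk v.transpose := by
  simp [blockDiag, Matrix.fromBlocks_transpose]

theorem blockDiag_map {B : Type u} [CStarAlgebra B] (hk : k ≤ n) (v : Matrix (Fin k) (Fin k) A)
    (f : A →⋆ₐ[ℂ] B) : (blockDiag hk v).map f = blockDiag hk (v.map f) := by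
  have h : (Matrix.fromBlocks v 0 0 (1 : Matrix (Fin (n - k)) (Fin (n - k)) A)).map f =
      Matrix.fromBlocks (v.map f) 0 0 1 := by
    rw [Matrix.fromBlocks_map, Matrix.map_zero _ (map_zero f), Matrix.map_zero _ (map_zero f),
      Matrix.map_one _ (map_zero f) (map_one f)]
  rw [blockDiag, blockDiag, ← h]; rfl

theorem isBiunitary_blockDiag (hk : k ≤ n) {v : Matrix (Fin k) (Fin k) A} (hv : IsBiunitary v) :
    IsBiunitary (blockDiag hk v) := by
  obtain ⟨⟨h1, h2⟩, h3, h4⟩ := hv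
  refine ⟨⟨?_, ?_⟩, ?_, ?_⟩
  · rw [blockDiag_star, blockDiag_mul, h1, blockDiag_one]
  · rw [blockDiag_star, blockDiag_mul, h2, blockDiag_one]
  · rw [blockDiag_transpose, blockDiag_star, blockDiag_mul, h3, blockDiag_one]
  · rw [blockDiag_transpose, blockDiag_star, blockDiag_mul, h4, blockDiag_one]

theorem blockDiag_apply (hk : k ≤ n) (v : Matrix (Fin k) (Fin k) A) (i j : Fin k) :
    blockDiag hk v (Fin.castLE hk i) (Fin.castLE hk j) = v i j := by
  have h : ∀ i : Fin k, Fin.castLE hk i = blockEquiv hk (Sum.inl i) := fun i => by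
    ext; simp [blockEquiv]
  rw [h, h]
  simp [blockDiag]

end Block

/-- The quantum subgroup `U_k⁺ ⊂ U_n⁺`, embedded via `g ↦ diag(g, 1_{n-k})`. -/
def uPlusSubgroup {n k : ℕ} (hk : k ≤ n) : QuantumSubgroup.{u} n :=
  QuantumSubgroup.ofMatrix (UPlus.comul k) (blockDiag hk (UPlus.gen k))
    (isBiunitary_blockDiag hk UPlus.isBiunitary_gen)
    (UPlus.surjective_of_gen _ fun i j =>
      ⟨UPlus.gen n (Fin.castLE hk i) (Fin.castLE hk j),
        (UPlus.lift_gen _ _ _ _).trans (blockDiag_apply hk _ i j)⟩)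
    (fun i j => by
      have h1 : (UPlus.gen k).map (UPlus.comul.{u} k) = tensorSquare (UPlus.gen k) := by
        ext i j; exact UPlus.comul_gen i j
      have h2 := blockDiag_map hk (UPlus.gen k) (UPlus.comul.{u} k)
      rw [h1, tensorSquare_eq, ← blockDiag_mul, ← blockDiag_map, ← blockDiag_map,
        ← tensorSquare_eq] at h2
      exact congrFun (congrFun h2 i) j)

section Dual

variable {Γ : Type u} [Group Γ] {n : ℕ}

/-- A complex matrix, regarded as a scalar matrix over a C*-algebra. -/
def scalarMatrix (A : Type u) [CStarAlgebra A] (J : Matrix (Fin n) (Fin n) ℂ) :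
    Matrix (Fin n) (Fin n) A := J.map (algebraMap ℂ A)

/-- The matrix `J D J*`, where `D = diag(g_1, …, g_n)`. -/
def dualMatrix (g : Fin n → Γ) (J : Matrix.unitaryGroup (Fin n) ℂ) :
    Matrix (Fin n) (Fin n) (GroupCStar Γ) :=
  scalarMatrix (GroupCStar Γ) J * Matrix.diagonal (fun r => GroupCStar.δ (g r)) *
    scalarMatrix (GroupCStar Γ) (star (J : Matrix (Fin n) (Fin n) ℂ))

variable {A : Type u} [CStarAlgebra A]

theorem scalarMatrix_mul (J K : Matrix (Fin n) (Fin n) ℂ) :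
    scalarMatrix A J * scalarMatrix A K = scalarMatrix A (J * K) :=
  (Matrix.map_mul (f := algebraMap ℂ A)).symm

theorem scalarMatrix_one : scalarMatrix A (1 : Matrix (Fin n) (Fin n) ℂ) = 1 :=
  Matrix.map_one _ (map_zero _) (map_one _)

theorem scalarMatrix_star (J : Matrix (Fin n) (Fin n) ℂ) :
    star (scalarMatrix A J) = scalarMatrix A (star J) := by
  ext i j
  exact (algebraMap_star_comm (J j i)).symm

theorem scalarMatrix_mem {J : Matrix (Fin n) (Fin n) ℂ}
    (hJ : J ∈ unitary (Matrix (Fin n) (Fin n) ℂ)) :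
    scalarMatrix A J ∈ unitary (Matrix (Fin n) (Fin n) A) := by
  rw [Unitary.mem_iff, scalarMatrix_star, scalarMatrix_mul, scalarMatrix_mul, hJ.1, hJ.2,
    scalarMatrix_one]
  exact ⟨rfl, rfl⟩

theorem transpose_scalar_mul (J : Matrix (Fin n) (Fin n) ℂ) (M : Matrix (Fin n) (Fin n) A) :
    (scalarMatrix A J * M).transpose = M.transpose * (scalarMatrix A J).transpose := by
  ext i j
  simp only [Matrix.transpose_apply, Matrix.mul_apply, scalarMatrix, Matrix.map_apply]
  exact Finset.sum_congr rfl fun k _ => Algebra.commutes _ _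

theorem transpose_mul_scalar (J : Matrix (Fin n) (Fin n) ℂ) (M : Matrix (Fin n) (Fin n) A) :
    (M * scalarMatrix A J).transpose = (scalarMatrix A J).transpose * M.transpose := by
  ext i j
  simp only [Matrix.transpose_apply, Matrix.mul_apply, scalarMatrix, Matrix.map_apply]
  exact Finset.sum_congr rfl fun k _ => (Algebra.commutes _ _).symm

theorem transpose_mem_unitary {J : Matrix (Fin n) (Fin n) ℂ}
    (hJ : J ∈ unitary (Matrix (Fin n) (Fin n) ℂ)) :
    J.transpose ∈ unitary (Matrix (Fin n) (Fin n) ℂ) := by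
  have h : star J.transpose = (star J).transpose := rfl
  rw [Unitary.mem_iff, h, ← Matrix.transpose_mul, ← Matrix.transpose_mul, hJ.1, hJ.2,
    Matrix.transpose_one]
  exact ⟨rfl, rfl⟩

theorem diagonal_mem (g : Fin n → Γ) :
    Matrix.diagonal (fun r => GroupCStar.δ (g r)) ∈
      unitary (Matrix (Fin n) (Fin n) (GroupCStar Γ)) := by
  have h : star (Matrix.diagonal (fun r => GroupCStar.δ (g r))) =
      Matrix.diagonal (fun r => GroupCStar.δ (g r)⁻¹) := by
    rw [Matrix.star_eq_conjTranspose, Matrix.diagonal_conjTranspose]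
    congr 1
    ext r
    exact GroupCStar.star_δ _
  rw [Unitary.mem_iff, h, Matrix.diagonal_mul_diagonal, Matrix.diagonal_mul_diagonal]
  simp [← GroupCStar.δ_mul, GroupCStar.δ_one]

theorem isBiunitary_dualMatrix (g : Fin n → Γ) (J : Matrix.unitaryGroup (Fin n) ℂ) :
    IsBiunitary (dualMatrix g J) := by
  have hJ : (J : Matrix (Fin n) (Fin n) ℂ) ∈ unitary (Matrix (Fin n) (Fin n) ℂ) := J.2
  refine ⟨mul_mem (mul_mem (scalarMatrix_mem hJ) (diagonal_mem g))
    (scalarMatrix_mem (Unitary.star_mem hJ)), ?_⟩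
  rw [dualMatrix, transpose_mul_scalar, transpose_scalar_mul, Matrix.diagonal_transpose]
  exact mul_mem (scalarMatrix_mem (transpose_mem_unitary (Unitary.star_mem hJ)))
    (mul_mem (diagonal_mem g) (scalarMatrix_mem (transpose_mem_unitary hJ)))

theorem scalarMatrix_map {B : Type u} [CStarAlgebra B] (f : A →⋆ₐ[ℂ] B)
    (J : Matrix (Fin n) (Fin n) ℂ) : (scalarMatrix A J).map f = scalarMatrix B J := by
  ext i j
  simp only [scalarMatrix, Matrix.map_apply, AlgHomClass.commutes f]

theorem dualMatrix_map {B : Type u} [CStarAlgebra B] (f : GroupCStar Γ →⋆ₐ[ℂ] B) (g : Fin n → Γ)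
    (J : Matrix.unitaryGroup (Fin n) ℂ) : (dualMatrix g J).map f =
      scalarMatrix B J * Matrix.diagonal (fun r => f (GroupCStar.δ (g r))) *
        scalarMatrix B (star (J : Matrix (Fin n) (Fin n) ℂ)) := by
  have hm : ∀ M N : Matrix (Fin n) (Fin n) (GroupCStar Γ), (M * N).map f = M.map f * N.map f :=
    fun M N => Matrix.map_mul (f := (f : GroupCStar Γ →+* B))
  rw [dualMatrix, hm, hm, scalarMatrix_map, scalarMatrix_map, Matrix.diagonal_map (map_zero f)]

theorem comul_dualMatrix (g : Fin n → Γ) (J : Matrix.unitaryGroup (Fin n) ℂ) :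
    (dualMatrix g J).map (GroupCStar.comul (Γ := Γ)) = tensorSquare (dualMatrix g J) := by
  rw [tensorSquare_eq, dualMatrix_map, dualMatrix_map, dualMatrix_map]
  set B := MinTensor (GroupCStar Γ) (GroupCStar Γ)
  have hJ : scalarMatrix B (star (J : Matrix (Fin n) (Fin n) ℂ)) * scalarMatrix B J = 1 := by
    rw [scalarMatrix_mul, (show star (J : Matrix (Fin n) (Fin n) ℂ) * J = 1 from J.2.1),
      scalarMatrix_one]
  have hD : Matrix.diagonal (fun r => GroupCStar.comul (GroupCStar.δ (g r))) =
      Matrix.diagonal (fun r => (MinTensor.inl (GroupCStar.δ (g r)) : B)) *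
        Matrix.diagonal (fun r => (MinTensor.inr (GroupCStar.δ (g r)) : B)) := by
    rw [Matrix.diagonal_mul_diagonal]
    congr 1
    ext r
    rw [GroupCStar.comul_δ, MinTensor.inl_mul_inr]
  rw [hD]
  simp only [mul_assoc]
  rw [← mul_assoc (scalarMatrix B (star (J : Matrix (Fin n) (Fin n) ℂ))) (scalarMatrix B J), hJ,
    one_mul]

theorem surjective_dual (g : Fin n → Γ) (hg : Subgroup.closure (Set.range g) = ⊤)
    (J : Matrix.unitaryGroup (Fin n) ℂ) :
    Function.Surjective (UPlus.lift (dualMatrix g J) (isBiunitary_dualMatrix g J)) := by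
  set f := UPlus.lift (dualMatrix g J) (isBiunitary_dualMatrix g J) with hf
  have hgen : ∀ r, GroupCStar.δ (g r) ∈ f.range := by
    intro r
    have h1 : (UPlus.gen n).map f = dualMatrix g J := by
      ext i j; exact UPlus.lift_gen _ (isBiunitary_dualMatrix g J) i j
    have hm : ∀ M N : Matrix (Fin n) (Fin n) (UPlus.{u} n), (M * N).map f = M.map f * N.map f :=
      fun M N => Matrix.map_mul (f := (f : UPlus.{u} n →+* GroupCStar Γ))
    have hJ : scalarMatrix (GroupCStar Γ) (star (J : Matrix (Fin n) (Fin n) ℂ)) *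
        scalarMatrix (GroupCStar Γ) J = 1 := by
      rw [scalarMatrix_mul, (show star (J : Matrix (Fin n) (Fin n) ℂ) * J = 1 from J.2.1),
        scalarMatrix_one]
    have h3 : (scalarMatrix (UPlus.{u} n) (star (J : Matrix (Fin n) (Fin n) ℂ)) * UPlus.gen n *
        scalarMatrix (UPlus.{u} n) J).map f =
          Matrix.diagonal (fun r => GroupCStar.δ (g r)) := by
      rw [hm, hm, h1, scalarMatrix_map, scalarMatrix_map, dualMatrix]
      simp only [mul_assoc]
      rw [hJ, mul_one, ← mul_assoc, hJ, one_mul]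
    refine ⟨_, (congrFun (congrFun h3 r) r).trans (Matrix.diagonal_apply_eq _ r)⟩
  have hall : ∀ x : Γ, GroupCStar.δ x ∈ f.range := by
    intro x
    have hx : x ∈ Subgroup.closure (Set.range g) := hg ▸ Subgroup.mem_top x
    induction hx using Subgroup.closure_induction with
    | mem x hx => obtain ⟨r, rfl⟩ := hx; exact hgen r
    | one => rw [GroupCStar.δ_one]; exact one_mem _
    | mul x y _ _ hx hy => rw [GroupCStar.δ_mul]; exact mul_mem hx hy
    | inv x _ hx => rw [← GroupCStar.star_δ]; exact star_mem hx
  refine surjective_of_denseRange f (GroupCStar.dense_span.mono ?_)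
  have : Submodule.span ℂ (Set.range (GroupCStar.δ : Γ → GroupCStar Γ)) ≤
      Subalgebra.toSubmodule f.range.toSubalgebra := by
    rw [Submodule.span_le]
    rintro _ ⟨x, rfl⟩
    exact hall x
  exact fun y hy => this hy

/-- The group dual `Γ̂`, where `Γ = ⟨g_1, …, g_n⟩`, as a quantum subgroup of `U_n⁺`: the algebra
`C*(Γ)` with `Δ(g) = g ⊗ g`, embedded via `u ↦ J D J*`, where `D = diag(g_1, …, g_n)`. -/
def dual (g : Fin n → Γ) (hg : Subgroup.closure (Set.range g) = ⊤)
    (J : Matrix.unitaryGroup (Fin n) ℂ) : QuantumSubgroup.{u} n :=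
  QuantumSubgroup.ofMatrix GroupCStar.comul (dualMatrix g J) (isBiunitary_dualMatrix g J)
    (surjective_dual g hg J) fun i j => congrFun (congrFun (comul_dualMatrix g J) i) j

theorem closure_range_mk {g : Fin n → Γ} (hg : Subgroup.closure (Set.range g) = ⊤)
    (N : Subgroup Γ) [N.Normal] :
    Subgroup.closure (Set.range fun r => (QuotientGroup.mk (g r) : Γ ⧸ N)) = ⊤ := by
  have h := congrArg (Subgroup.map (QuotientGroup.mk' N)) hg
  rw [MonoidHom.map_closure, ← Set.range_comp,
    Subgroup.map_top_of_surjective _ (QuotientGroup.mk'_surjective N)] at h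
  exact h

end Dual

namespace QuantumSubgroup

variable {n : ℕ}

/-- `K ⊂ G` as quantum subgroups of `U_n⁺`: the morphism `C(U_n⁺) → C(K)` factors through
`C(U_n⁺) → C(G)`. -/
def IsSubgroup (K G : QuantumSubgroup.{u} n) : Prop :=
  RingHom.ker G.proj ≤ RingHom.ker K.proj

/-- Factorisation of a *-homomorphism through a surjective *-homomorphism. -/
def factor {A B C : Type u} [CStarAlgebra A] [CStarAlgebra B] [CStarAlgebra C]
    (f : A →⋆ₐ[ℂ] B) (hf : Function.Surjective f) (g : A →⋆ₐ[ℂ] C)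
    (h : RingHom.ker f ≤ RingHom.ker g) : B →⋆ₐ[ℂ] C :=
  have key : ∀ a a', f a = f a' → g a = g a' := fun a a' e => by
    rw [← sub_eq_zero, ← map_sub]
    exact h (by rw [RingHom.mem_ker, map_sub, sub_eq_zero]; exact e)
  have e : ∀ b, f (Function.surjInv hf b) = b := Function.surjInv_eq hf
  { toFun := fun b => g (Function.surjInv hf b)
    map_one' := by rw [← map_one g]; exact key _ _ (by rw [e, map_one])
    map_mul' := fun x y => by rw [← map_mul]; exact key _ _ (by rw [map_mul, e, e, e])
    map_zero' := by rw [← map_zero g]; exact key _ _ (by rw [e, map_zero])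
    map_add' := fun x y => by rw [← map_add]; exact key _ _ (by rw [map_add, e, e, e])
    commutes' := fun c => by
      rw [← AlgHomClass.commutes g c]; exact key _ _ (by rw [e, AlgHomClass.commutes f c])
    map_star' := fun x => by rw [← map_star]; exact key _ _ (by rw [map_star, e, e]) }

theorem factor_apply {A B C : Type u} [CStarAlgebra A] [CStarAlgebra B] [CStarAlgebra C]
    (f : A →⋆ₐ[ℂ] B) (hf : Function.Surjective f) (g : A →⋆ₐ[ℂ] C)
    (h : RingHom.ker f ≤ RingHom.ker g) (a : A) : factor f hf g h (f a) = g a := by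
  change g (Function.surjInv hf (f a)) = g a
  rw [← sub_eq_zero, ← map_sub]
  exact h (by rw [RingHom.mem_ker, map_sub, sub_eq_zero]; exact Function.surjInv_eq hf _)

/-- The surjective morphism `π : C(G) → C(K)` associated with an inclusion `K ⊂ G`; it is determined
by the property that it intertwines the morphisms from `C(U_n⁺)`. -/
def restrict {K G : QuantumSubgroup.{u} n} (h : K.IsSubgroup G) : G.carrier →⋆ₐ[ℂ] K.carrier :=
  factor G.proj G.surjective K.proj h

theorem restrict_proj {K G : QuantumSubgroup.{u} n} (h : K.IsSubgroup G) (x : UPlus.{u} n) :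
    restrict h (G.proj x) = K.proj x := factor_apply _ _ _ _ x

/-- The algebra `C(G/K) = {f ∈ C(G) | (π ⊗ id) Δ f = 1 ⊗ f}`, for `K ⊂ G`. -/
def quotientAlgebra {K G : QuantumSubgroup.{u} n} (h : K.IsSubgroup G) :
    StarSubalgebra ℂ G.carrier :=
  StarAlgHom.equalizer
    ((MinTensor.map (restrict h) (StarAlgHom.id ℂ G.carrier)).comp G.comul)
    (MinTensor.inr : G.carrier →⋆ₐ[ℂ] MinTensor K.carrier G.carrier)

theorem mem_quotientAlgebra {K G : QuantumSubgroup.{u} n} (h : K.IsSubgroup G) (f : G.carrier) :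
    f ∈ quotientAlgebra h ↔ MinTensor.map (restrict h) (StarAlgHom.id ℂ G.carrier) (G.comul f) =
      MinTensor.tmul 1 f := Iff.rfl

/-- The unital C*-subalgebra of `C(G)` generated by the coordinates `u_ij` with `i > k`, where
`1 ≤ i, j ≤ n`; the row `i` is the element `i - 1` of `Fin n`. -/
def rowAlgebra (G : QuantumSubgroup.{u} n) (k : ℕ) : StarSubalgebra ℂ G.carrier :=
  (StarAlgebra.adjoin ℂ
    {x : G.carrier | ∃ i j : Fin n, k ≤ i.val ∧ x = G.proj (UPlus.gen n i j)}).topologicalClosure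

/-- Isomorphism of quantum subgroups of `U_n⁺`: an isomorphism of C*-algebras intertwining the
comultiplications and the morphisms from `C(U_n⁺)`. -/
def Isomorphic (K L : QuantumSubgroup.{u} n) : Prop :=
  ∃ θ : K.carrier ≃⋆ₐ[ℂ] L.carrier,
    (∀ x, L.comul (θ x) =
      MinTensor.map (θ : K.carrier →⋆ₐ[ℂ] L.carrier) (θ : K.carrier →⋆ₐ[ℂ] L.carrier) (K.comul x)) ∧
    ∀ x, θ (K.proj x) = L.proj x

section Inter

variable (G H : QuantumSubgroup.{u} n)

/-- The C*-seminorms on `C(U_n⁺)` vanishing on `ker(C(U_n⁺) → C(G)) + ker(C(U_n⁺) → C(H))`. -/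
def interSeminorms : Set (CStarSeminorm (UPlus.{u} n)) :=
  {p | ∀ x ∈ RingHom.ker G.proj ⊔ RingHom.ker H.proj, p x = 0}

theorem bddAbove_inter (x : UPlus.{u} n) :
    BddAbove ((fun p : CStarSeminorm (UPlus.{u} n) => p x) '' interSeminorms G H) := by
  refine ⟨‖x‖, ?_⟩
  rintro _ ⟨p, -, rfl⟩
  change p x ≤ _
  rw [← CStarSeminorm.norm_of]
  exact NonUnitalStarAlgHom.norm_apply_le p.of x

/-- The quotient C*-norm on `C(U_n⁺)` modulo the sum of the two kernels, written as the largest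
C*-seminorm vanishing on this sum. -/
def interSeminorm : CStarSeminorm (UPlus.{u} n) :=
  CStarSeminorm.sup (interSeminorms G H) (bddAbove_inter G H)

/-- The algebra `C(G ∩ H)`: the quotient C*-algebra of `C(U_n⁺)` by the sum of the kernels of
`C(U_n⁺) → C(G)` and `C(U_n⁺) → C(H)`; equivalently, the push-out of these two morphisms. -/
def InterAlg : Type u := (interSeminorm G H).Compl

instance : CStarAlgebra (InterAlg G H) :=
  inferInstanceAs (CStarAlgebra (interSeminorm G H).Compl)

/-- The quotient map `C(U_n⁺) → C(G ∩ H)`. -/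
def interProj : UPlus.{u} n →⋆ₐ[ℂ] InterAlg G H := (interSeminorm G H).of

theorem interProj_surjective : Function.Surjective (interProj G H) :=
  surjective_of_denseRange _ (interSeminorm G H).denseRange_of

theorem ker_le_ker_interProj :
    RingHom.ker G.proj ⊔ RingHom.ker H.proj ≤ RingHom.ker (interProj G H) := by
  intro x hx
  rw [RingHom.mem_ker, ← norm_eq_zero]
  change ‖(interSeminorm G H).of x‖ = 0
  rw [CStarSeminorm.norm_of]
  refine le_antisymm (Real.sSup_le ?_ le_rfl) ((interSeminorm G H).nonneg x)
  rintro _ ⟨p, hp, rfl⟩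
  exact (hp x hx).le

/-- The universal property of the push-out. -/
def interLift {B : Type u} [CStarAlgebra B] (f : UPlus.{u} n →⋆ₐ[ℂ] B)
    (hf : RingHom.ker G.proj ⊔ RingHom.ker H.proj ≤ RingHom.ker f) : InterAlg G H →⋆ₐ[ℂ] B :=
  CStarSeminorm.lift (p := interSeminorm G H) f fun x =>
    CStarSeminorm.le_sup (S := interSeminorms G H) (p := CStarSeminorm.ofHom f)
      (fun x hx => by
        rw [CStarSeminorm.ofHom_apply, norm_eq_zero]
        exact hf hx) x

theorem interLift_proj {B : Type u} [CStarAlgebra B] (f : UPlus.{u} n →⋆ₐ[ℂ] B)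
    (hf : RingHom.ker G.proj ⊔ RingHom.ker H.proj ≤ RingHom.ker f) (x : UPlus.{u} n) :
    interLift G H f hf (interProj G H x) = f x :=
  CStarSeminorm.lift_of (p := interSeminorm G H) _ _ _

theorem ker_le_ker_tensor (L : QuantumSubgroup.{u} n) {A : Type u} [CStarAlgebra A]
    (q : UPlus.{u} n →⋆ₐ[ℂ] A) (h : RingHom.ker L.proj ≤ RingHom.ker q) :
    RingHom.ker L.proj ≤ RingHom.ker ((MinTensor.map q q).comp (UPlus.comul n)) := by
  intro x hx
  have hq : q = (factor L.proj L.surjective q h).comp L.proj := by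
    ext y; exact (factor_apply _ L.surjective _ h y).symm
  have hc : MinTensor.map q q = (MinTensor.map (factor L.proj L.surjective q h)
      (factor L.proj L.surjective q h)).comp (MinTensor.map L.proj L.proj) := by
    refine MinTensor.hom_ext fun a b => ?_
    rw [StarAlgHom.comp_apply, MinTensor.map_tmul, MinTensor.map_tmul, MinTensor.map_tmul,
      factor_apply, factor_apply]
  rw [RingHom.mem_ker, StarAlgHom.comp_apply, hc, StarAlgHom.comp_apply, ← L.comul_proj,
    (RingHom.mem_ker).1 hx, map_zero, map_zero]

/-- The intersection `G ∩ H` of two quantum subgroups of `U_n⁺`, with the comultiplication inherited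
from `C(U_n⁺)`. -/
def inter : QuantumSubgroup.{u} n where
  carrier := InterAlg G H
  comul := interLift G H ((MinTensor.map (interProj G H) (interProj G H)).comp (UPlus.comul n))
    (sup_le
      (ker_le_ker_tensor G _ (le_sup_left.trans (ker_le_ker_interProj G H)))
      (ker_le_ker_tensor H _ (le_sup_right.trans (ker_le_ker_interProj G H))))
  proj := interProj G H
  surjective := interProj_surjective G H
  comul_proj x := interLift_proj G H _ _ x

theorem inter_isSubgroup_left : (G.inter H).IsSubgroup G :=
  le_sup_left.trans (ker_le_ker_interProj G H)

end Inter

end QuantumSubgroup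

section KernelSum

variable {A B C : Type u} [CStarAlgebra A] [CStarAlgebra B] [CStarAlgebra C]

/-- Lifting with norm control inside the kernel of another *-homomorphism. -/
theorem exists_lift_mem_ker (f : A →⋆ₐ[ℂ] B) (h : A →⋆ₐ[ℂ] C) (a : A) (ha : h a = 0)
    (hsa : IsSelfAdjoint a) : ∃ a', h a' = 0 ∧ f a' = f a ∧ ‖a'‖ ≤ ‖f a‖ := by
  rcases (norm_nonneg (f a)).eq_or_lt with h0 | h0
  · exact ⟨0, map_zero h, by rw [map_zero, eq_comm, ← norm_eq_zero, ← h0], by simp⟩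
  set r := ‖f a‖ with hr
  have hm : ∀ t : ℝ, 0 < max r |t| := fun t => lt_max_of_lt_left h0
  let d : ℝ → ℝ := fun t => r / max r |t|
  have hd : Continuous d := Continuous.div continuous_const (by fun_prop) fun t => (hm t).ne'
  have hprod : cfc (fun t => t * d t) a = a * cfc d a := by
    rw [cfc_mul (fun t => t) d a (by fun_prop) hd.continuousOn, cfc_id' ℝ a]
  refine ⟨cfc (fun t => t * d t) a, by rw [hprod, map_mul, ha, zero_mul], ?_, ?_⟩
  · rw [StarAlgHomClass.map_cfc f _ a (by fun_prop) (continuous_hom f)]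
    conv_rhs => rw [← cfc_id' ℝ (f a) (hsa.map f)]
    refine cfc_congr fun t ht => ?_
    have : |t| ≤ r := by
      rcases subsingleton_or_nontrivial B with hB | hB
      · simp at ht
      · simpa using spectrum.norm_le_norm_of_mem ht
    simp only [d]
    rw [max_eq_left this, div_self h0.ne', mul_one]
  · refine norm_cfc_le h0.le fun t _ => ?_
    rw [Real.norm_eq_abs, abs_mul, abs_div, abs_of_pos h0, abs_of_pos (hm t), mul_div_assoc']
    rw [div_le_iff₀ (hm t), mul_comm]
    exact mul_le_mul_of_nonneg_left (le_max_right _ _) h0.le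

theorem isClosed_sup_ker (f : A →⋆ₐ[ℂ] B) (h : A →⋆ₐ[ℂ] C) :
    IsClosed ((RingHom.ker f ⊔ RingHom.ker h : Ideal A) : Set A) := by
  let I : AddSubgroup A := (RingHom.ker h).toAddSubgroup
  have hI : ∀ a, a ∈ I ↔ h a = 0 := fun a => RingHom.mem_ker
  have hIc : IsClosed (I : Set A) := by
    have : (I : Set A) = h ⁻¹' {0} := by ext a; exact hI a
    rw [this]
    exact isClosed_singleton.preimage (continuous_hom h)
  have : CompleteSpace I := hIc.completeSpace_coe
  let F : NormedAddGroupHom I B :=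
    { toFun := fun a => f (a : A)
      map_add' := fun a b => map_add f (a : A) (b : A)
      bound' := ⟨1, fun x => by
        rw [one_mul]; exact NonUnitalStarAlgHom.norm_apply_le f (x : A)⟩ }
  have hyp : ∀ b ∈ F.range, ∃ g, F g = b ∧ ‖g‖ ≤ 2 * ‖b‖ := by
    rintro _ ⟨⟨a, ha⟩, rfl⟩
    rw [hI] at ha
    change ∃ g : I, f g = f a ∧ ‖g‖ ≤ 2 * ‖f a‖
    have hre : f (realPart a : A) = (realPart (f a) : B) := by
      simp [realPart_apply_coe, ← Complex.coe_smul, map_star f]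
    have him : f (imaginaryPart a : A) = (imaginaryPart (f a) : B) := by
      simp [imaginaryPart_apply_coe, ← Complex.coe_smul, map_star f]
    obtain ⟨x, hx0, hx, hxn⟩ := exists_lift_mem_ker f h (realPart a : A)
      (by simp [realPart_apply_coe, ← Complex.coe_smul, map_star h, ha]) (realPart a).2
    obtain ⟨y, hy0, hy, hyn⟩ := exists_lift_mem_ker f h (imaginaryPart a : A)
      (by simp [imaginaryPart_apply_coe, ← Complex.coe_smul, map_star h, ha]) (imaginaryPart a).2
    refine ⟨⟨x + Complex.I • y, (hI _).2 (by rw [map_add, map_smul, hx0, hy0]; simp)⟩, ?_, ?_⟩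
    · change f (x + Complex.I • y) = f a
      rw [map_add, map_smul, hx, hy, hre, him, realPart_add_I_smul_imaginaryPart]
    · have h1 : ‖x‖ ≤ ‖f a‖ := hxn.trans (hre ▸ realPart.norm_le (f a))
      have h2 : ‖y‖ ≤ ‖f a‖ := hyn.trans (him ▸ imaginaryPart.norm_le (f a))
      calc ‖x + Complex.I • y‖ ≤ ‖x‖ + ‖Complex.I • y‖ := norm_add_le _ _
        _ ≤ 2 * ‖f a‖ := by rw [norm_smul, Complex.norm_I]; linarith
  have hset : ((RingHom.ker f ⊔ RingHom.ker h : Ideal A) : Set A) =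
      f ⁻¹' (F.range.topologicalClosure : Set B) := by
    ext x
    rw [SetLike.mem_coe, Submodule.mem_sup]
    constructor
    · rintro ⟨y, hy, z, hz, rfl⟩
      refine AddSubgroup.le_topologicalClosure _ ⟨⟨z, hz⟩, ?_⟩
      change f z = f (y + z)
      rw [map_add, (RingHom.mem_ker).1 hy, zero_add]
    · intro hx
      obtain ⟨z, hz, -⟩ := controlled_closure_of_complete two_pos one_pos hyp (f x) hx
      refine ⟨x - z, ?_, z, z.2, sub_add_cancel _ _⟩
      rw [RingHom.mem_ker, map_sub, sub_eq_zero]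
      exact hz.symm
  rw [hset]
  exact (AddSubgroup.isClosed_topologicalClosure _).preimage (continuous_hom f)

/-- An approximate unit for a single element `i` of an ideal. -/
theorem exists_approx (i : A) {ε : ℝ} (hε : 0 < ε) :
    ∃ e b : A, e = b * i ∧ star e = e ∧ ‖1 - e‖ ≤ 1 ∧ ‖i * (1 - e)‖ * ‖i * (1 - e)‖ ≤ ε := by
  let _ := CStarAlgebra.spectralOrder A
  let _ := CStarAlgebra.spectralOrderedRing A
  set a := star i * i with ha
  have ha0 : 0 ≤ a := star_mul_self_nonneg i
  have hsa : IsSelfAdjoint a := IsSelfAdjoint.star_mul_self i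
  have hsp : ∀ t ∈ spectrum ℝ a, 0 ≤ t := fun t ht => spectrum_nonneg_of_nonneg ha0 ht
  have hc : ContinuousOn (fun t : ℝ => (t + ε)⁻¹) (spectrum ℝ a) :=
    ContinuousOn.inv₀ (by fun_prop) fun t ht => by have := hsp t ht; positivity
  have hprod : cfc (fun t : ℝ => (t + ε)⁻¹ * t) a = cfc (fun t : ℝ => (t + ε)⁻¹) a * a := by
    rw [cfc_mul _ (fun t => t) a hc (by fun_prop), cfc_id' ℝ a]
  have hc2 : ContinuousOn (fun t : ℝ => (t + ε)⁻¹ * t) (spectrum ℝ a) :=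
    hc.mul continuousOn_id
  set e := cfc (fun t : ℝ => (t + ε)⁻¹ * t) a with he
  have hse : star e = e := cfc_predicate (R := ℝ) (p := IsSelfAdjoint) _ a
  have h1e : 1 - e = cfc (fun t : ℝ => 1 - (t + ε)⁻¹ * t) a := by
    rw [cfc_sub _ _ a (by fun_prop) hc2, cfc_const_one ℝ a]
  have hval : ∀ t ∈ spectrum ℝ a, 1 - (t + ε)⁻¹ * t = ε / (t + ε) := fun t ht => by
    have := hsp t ht
    field_simp
    ring
  refine ⟨e, cfc (fun t : ℝ => (t + ε)⁻¹) a * star i, ?_, hse, ?_, ?_⟩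
  · rw [hprod, ha, mul_assoc]
  · rw [h1e]
    refine norm_cfc_le zero_le_one fun t ht => ?_
    have := hsp t ht
    rw [hval t ht, Real.norm_of_nonneg (by positivity), div_le_one (by positivity)]
    linarith
  · have hs1 : star (1 - e) = 1 - e := by rw [star_sub, star_one, hse]
    rw [← CStarRing.norm_star_mul_self, star_mul, hs1]
    have : (1 - e) * star i * (i * (1 - e)) =
        cfc (fun t : ℝ => (1 - (t + ε)⁻¹ * t) * (t * (1 - (t + ε)⁻¹ * t))) a := by
      have hc3 : ContinuousOn (fun t : ℝ => 1 - (t + ε)⁻¹ * t) (spectrum ℝ a) :=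
        continuousOn_const.sub hc2
      have hc4 : ContinuousOn (fun t : ℝ => t * (1 - (t + ε)⁻¹ * t)) (spectrum ℝ a) :=
        continuousOn_id.mul hc3
      rw [cfc_mul _ _ a hc3 hc4, cfc_mul (fun t => t) _ a (by fun_prop) hc3,
        cfc_id' ℝ a, ← h1e, ha]
      simp only [mul_assoc]
    rw [this]
    refine norm_cfc_le hε.le fun t ht => ?_
    have h0 := hsp t ht
    rw [hval t ht, Real.norm_of_nonneg (by positivity)]
    rw [show ε / (t + ε) * (t * (ε / (t + ε))) = ε * (t * ε / (t + ε) ^ 2) by field_simp]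
    refine mul_le_of_le_one_right hε.le ?_
    rw [div_le_one (by positivity)]
    nlinarith

/-- The quotient seminorm of a closed self-adjoint two-sided ideal is a C*-seminorm. -/
def idealSeminorm (I : Ideal A) (hr : ∀ x ∈ I, ∀ a, x * a ∈ I) (hs : ∀ x ∈ I, star x ∈ I) :
    CStarSeminorm A := by
  let q : A → ℝ := fun x => Metric.infDist x (I : Set A)
  have hne : (I : Set A).Nonempty := ⟨0, I.zero_mem⟩
  have q0 : ∀ x, 0 ≤ q x := fun x => Metric.infDist_nonneg
  have qle : ∀ x, ∀ i ∈ I, q x ≤ ‖x - i‖ := fun x i hi => by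
    rw [← dist_eq_norm]; exact Metric.infDist_le_dist_of_mem hi
  have qlt : ∀ x, ∀ ε > 0, ∃ i ∈ I, ‖x - i‖ < q x + ε := fun x ε hε => by
    obtain ⟨i, hi, h⟩ := (Metric.infDist_lt_iff hne).1 (lt_add_of_pos_right (q x) hε)
    exact ⟨i, hi, by rwa [← dist_eq_norm]⟩
  have qmul : ∀ x y, q (x * y) ≤ q x * q y := by
    intro x y
    refine le_of_forall_pos_le_add fun δ hδ => ?_
    obtain ⟨ε, hε, hεδ⟩ : ∃ ε > 0, (q x + ε) * (q y + ε) ≤ q x * q y + δ := by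
      have hcont : Filter.Tendsto (fun ε : ℝ => (q x + ε) * (q y + ε)) (nhdsWithin 0 (Set.Ioi 0))
          (nhds ((q x + 0) * (q y + 0))) :=
        (Continuous.tendsto (by fun_prop) 0).mono_left nhdsWithin_le_nhds
      have := hcont.eventually (gt_mem_nhds
        (show (q x + 0) * (q y + 0) < q x * q y + δ by simpa using hδ))
      obtain ⟨ε, h1, h2⟩ := (this.and self_mem_nhdsWithin).exists
      exact ⟨ε, h2, h1.le⟩
    obtain ⟨i, hi, hxi⟩ := qlt x ε hε
    obtain ⟨j, hj, hyj⟩ := qlt y ε hε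
    have hmem : x * j + i * y - i * j ∈ I :=
      I.sub_mem (I.add_mem (I.mul_mem_left x hj) (hr i hi y)) (hr i hi j)
    calc q (x * y) ≤ ‖x * y - (x * j + i * y - i * j)‖ := qle _ _ hmem
      _ = ‖(x - i) * (y - j)‖ := by congr 1; noncomm_ring
      _ ≤ ‖x - i‖ * ‖y - j‖ := norm_mul_le _ _
      _ ≤ (q x + ε) * (q y + ε) := by
        gcongr
        have := q0 x
        positivity
      _ ≤ _ := hεδ
  have qstar : ∀ x, q (star x) ≤ q x := by
    intro x
    refine le_of_forall_pos_le_add fun ε hε => ?_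
    obtain ⟨i, hi, hxi⟩ := qlt x ε hε
    refine (qle _ _ (hs i hi)).trans ?_
    rw [← star_sub, norm_star]
    exact hxi.le
  have qsq : ∀ x, q x * q x ≤ q (star x * x) := by
    intro x
    refine le_of_forall_pos_le_add fun δ hδ => ?_
    obtain ⟨i, hi, hxi⟩ := qlt (star x * x) (δ / 2) (by positivity)
    obtain ⟨e, b, he, hse, h1, h2⟩ := exists_approx i (ε := (δ / 2) ^ 2) (by positivity)
    have heI : e ∈ I := he ▸ I.mul_mem_left b hi
    have h3 : ‖i * (1 - e)‖ ≤ δ / 2 := by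
      have : ‖i * (1 - e)‖ ^ 2 ≤ (δ / 2) ^ 2 := by rw [sq]; exact h2
      exact (abs_le_of_sq_le_sq' this (by positivity)).2
    have h4 : q x ≤ ‖x * (1 - e)‖ := by
      have := qle x (x * e) (I.mul_mem_left x heI)
      rwa [mul_sub, mul_one]
    have hs1 : star (1 - e) = 1 - e := by rw [star_sub, star_one, hse]
    calc q x * q x ≤ ‖x * (1 - e)‖ * ‖x * (1 - e)‖ :=
          mul_le_mul h4 h4 (q0 x) (norm_nonneg _)
      _ = ‖(1 - e) * (star x * x) * (1 - e)‖ := by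
        rw [← CStarRing.norm_star_mul_self, star_mul, hs1]; simp only [mul_assoc]
      _ = ‖(1 - e) * (star x * x - i) * (1 - e) + (1 - e) * (i * (1 - e))‖ := by
        congr 1; noncomm_ring
      _ ≤ ‖(1 - e) * (star x * x - i) * (1 - e)‖ + ‖(1 - e) * (i * (1 - e))‖ := norm_add_le _ _
      _ ≤ 1 * ‖star x * x - i‖ * 1 + 1 * (δ / 2) := by
        refine add_le_add ?_ ?_
        · refine (norm_mul_le _ _).trans (mul_le_mul ((norm_mul_le _ _).trans ?_) h1
            (norm_nonneg _) (by positivity))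
          exact mul_le_mul_of_nonneg_right h1 (norm_nonneg _)
        · exact (norm_mul_le _ _).trans (mul_le_mul h1 h3 (norm_nonneg _) zero_le_one)
      _ ≤ q (star x * x) + δ := by linarith
  exact
    { toSeminorm := Seminorm.ofSMulLE q
        (Metric.infDist_zero_of_mem I.zero_mem)
        (fun x y => by
          refine le_of_forall_pos_le_add fun ε hε => ?_
          obtain ⟨i, hi, hxi⟩ := qlt x (ε / 2) (by positivity)
          obtain ⟨j, hj, hyj⟩ := qlt y (ε / 2) (by positivity)
          refine (qle _ _ (I.add_mem hi hj)).trans ?_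
          rw [add_sub_add_comm]
          refine (norm_add_le _ _).trans ?_
          linarith)
        (fun c x => by
          have hc : q (algebraMap ℂ A c) ≤ ‖c‖ := by
            have h := qle (algebraMap ℂ A c) 0 I.zero_mem
            rw [sub_zero] at h
            refine h.trans ?_
            rcases subsingleton_or_nontrivial A with hA | hA
            · rw [Subsingleton.elim (algebraMap ℂ A c) 0, norm_zero]; exact norm_nonneg c
            · rw [norm_algebraMap']
          rw [Algebra.smul_def]
          exact (qmul _ _).trans (mul_le_mul_of_nonneg_right hc (q0 x)))
      mul_le := qmul
      star_mul_self := fun x =>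
        le_antisymm ((qmul _ _).trans (mul_le_mul_of_nonneg_right (qstar x) (q0 x))) (qsq x) }

theorem idealSeminorm_apply (I : Ideal A) (hr : ∀ x ∈ I, ∀ a, x * a ∈ I)
    (hs : ∀ x ∈ I, star x ∈ I) (x : A) : idealSeminorm I hr hs x = Metric.infDist x I := rfl

end KernelSum

/-- The kernel of `C(U_n⁺) → C(G ∩ H)` is the sum of the kernels of `C(U_n⁺) → C(G)` and
`C(U_n⁺) → C(H)`. -/
theorem QuantumSubgroup.ker_inter_proj {n : ℕ} (G H : QuantumSubgroup.{u} n) :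
    RingHom.ker (G.inter H).proj = RingHom.ker G.proj ⊔ RingHom.ker H.proj := by
  refine le_antisymm (fun x hx => ?_) (ker_le_ker_interProj G H)
  set I := RingHom.ker G.proj ⊔ RingHom.ker H.proj with hI
  have hr : ∀ x ∈ I, ∀ a, x * a ∈ I := by
    intro x hx a
    obtain ⟨y, hy, z, hz, rfl⟩ := Submodule.mem_sup.1 hx
    rw [add_mul]
    refine I.add_mem (le_sup_left (a := RingHom.ker G.proj) ?_)
      (le_sup_right (b := RingHom.ker H.proj) ?_)
    · rw [RingHom.mem_ker, map_mul, (RingHom.mem_ker).1 hy, zero_mul]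
    · rw [RingHom.mem_ker, map_mul, (RingHom.mem_ker).1 hz, zero_mul]
  have hs : ∀ x ∈ I, star x ∈ I := by
    intro x hx
    obtain ⟨y, hy, z, hz, rfl⟩ := Submodule.mem_sup.1 hx
    rw [star_add]
    refine I.add_mem (le_sup_left (a := RingHom.ker G.proj) ?_)
      (le_sup_right (b := RingHom.ker H.proj) ?_)
    · rw [RingHom.mem_ker, map_star, (RingHom.mem_ker).1 hy, star_zero]
    · rw [RingHom.mem_ker, map_star, (RingHom.mem_ker).1 hz, star_zero]
  have h0 : interSeminorm G H x = 0 := by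
    rw [← CStarSeminorm.norm_of, norm_eq_zero]
    exact (RingHom.mem_ker).1 hx
  have h1 : idealSeminorm I hr hs x ≤ interSeminorm G H x :=
    CStarSeminorm.le_sup (S := interSeminorms G H) (hS := bddAbove_inter G H)
      (p := idealSeminorm I hr hs)
      (fun y hy => Metric.infDist_zero_of_mem hy) x
  rw [h0, idealSeminorm_apply] at h1
  have hcl : IsClosed (I : Set (UPlus.{u} n)) := isClosed_sup_ker G.proj H.proj
  exact (hcl.mem_iff_infDist_zero ⟨0, I.zero_mem⟩).2 (le_antisymm h1 Metric.infDist_nonneg)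

/-- The set of all `g_r` such that `J_ir ≠ 0` for some `i > k`. -/
def rowSet {Γ : Type u} {n : ℕ} (g : Fin n → Γ) (J : Matrix.unitaryGroup (Fin n) ℂ) (k : ℕ) :
    Set Γ :=
  {x | ∃ r : Fin n, (∃ i : Fin n, k ≤ i.val ∧ J.val i r ≠ 0) ∧ x = g r}

/-- `C*(Λ)` as a subalgebra of `C*(Γ)`, for a subgroup `Λ ⊂ Γ`: the image of the canonical morphism
`C*(Λ) → C*(Γ)`. -/
def GroupCStar.ofSubgroup {Γ : Type u} [Group Γ] (Λ : Subgroup Γ) :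
    StarSubalgebra ℂ (GroupCStar Γ) := (GroupCStar.map Λ.subtype).range

end

end QSpace

/-! The entries of u = JDJ* are u_ij = ∑_r J_ir conj(J_jr) g_r, and uJ = JD. So the i-th row of u
spans the same space as those g_r with J_ir ≠ 0. The rows with i > k therefore generate C*(Λ), which
is `rowAlgebra_dual`. In the same way a morphism out of C*(Γ) brings u to the form diag(v, 1)
exactly when it sends every g_r in `rowSet` to 1 (`map_dualMatrix_eq_one_iff`). Hence C*(Θ) is the
largest quotient of C(U_n⁺) that factors through both C*(Γ) and C(U_k⁺). Since a quantum subgroup is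
determined by the kernel of its morphism from C(U_n⁺), H is the dual of Θ
(`inter_uPlusSubgroup_isomorphic`).

For a subgroup Λ the map C*(Λ) → C*(Γ) is injective because every unitary representation of Λ is
contained in the restriction of the representation of Γ induced from it
(`GroupCStar.map_subtype_injective`). Inducing the trivial representation gives Γ acting on ℓ²(Γ/Λ),
and its matrix coefficients show that a group element lying in C*(Λ) already lies in Λ. So Λ is
recovered from C*(Λ), and the equality of the algebras in the last statement becomes Λ = Λ', that
is, normality of Λ.

For N = Λ', the algebra C(G/H) is the fixed point algebra of the coaction g ↦ ḡ ⊗ g of C*(Γ/N).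
Elements of N are fixed. Conversely, slicing the first leg by the canonical trace of C*(Γ/N) sends ḡ
⊗ g to g if g ∈ N and to 0 otherwise, so it truncates to N, while it sends 1 ⊗ f to f. On the group
algebra this bounds the distance from f to its truncation by the failure of f to be fixed
(`exists_truncation`). Density and closedness of C*(N) then show that fixed elements belong to C*(N)
(`equalizer_quotientCoaction`).

Both norm arguments, for injectivity and for the slice, rest on the fact that Hilbert space
representations detect the norm of a C*-algebra (`norm_le_of_forall_rep`), proved by Hahn–Banach
separation and the GNS construction. -/

namespace QSpace

noncomputable section

/-! ### Positive functionals and detection of the norm by representations -/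

section States

open scoped ComplexOrder

variable {A : Type u} [CStarAlgebra A]

/-- A positive real functional on a C*-algebra gives a complex positive functional with the same
values on positive elements. -/
theorem exists_positiveLinearMap [PartialOrder A] [StarOrderedRing A] (f : A →ₗ[ℝ] ℝ)
    (hf : ∀ a, 0 ≤ a → 0 ≤ f a) :
    ∃ φ : A →ₚ[ℂ] ℂ, ∀ a, IsSelfAdjoint a → φ a = f a := by
  -- The functional f is only real linear and may be nonzero on skew-adjoint elements. Composing
  -- with the real part removes this, so that a ↦ g(a) - i g(ia) is real on self-adjoint elements.
  let g : A →ₗ[ℝ] ℝ := f.comp ((selfAdjoint.submodule ℝ A).subtype.comp realPart)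
  have hg : ∀ a, IsSelfAdjoint a → g a = f a := fun a ha => congrArg f ha.coe_realPart
  have hI : ∀ a, IsSelfAdjoint a → g (Complex.I • a) = 0 := fun a ha => by
    change f (realPart (Complex.I • a) : A) = 0
    rw [realPart_I_smul, ha.imaginaryPart]
    simp
  let ψ : A →ₗ[ℂ] ℂ := Module.Dual.extendRCLike (𝕜 := ℂ) g
  have hψ : ∀ a, IsSelfAdjoint a → ψ a = f a := fun a ha => by
    simp only [ψ, Module.Dual.extendRCLike_apply]
    change ((g a : ℝ) : ℂ) - Complex.I * ((g (Complex.I • a) : ℝ) : ℂ) = _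
    rw [hg a ha, hI a ha]
    simp
  refine ⟨PositiveLinearMap.mk₀ ψ fun a ha => ?_, hψ⟩
  rw [hψ a (IsSelfAdjoint.of_nonneg ha)]
  exact_mod_cast hf a ha

/-- The norm of an element of a C*-algebra is detected by its Hilbert space representations. -/
theorem norm_le_of_forall_rep (x : A) {M : ℝ} (hM : 0 ≤ M)
    (h : ∀ (F : Type u) [NormedAddCommGroup F] [InnerProductSpace ℂ F] [CompleteSpace F]
      (ρ : A →⋆ₐ[ℂ] (F →L[ℂ] F)), ‖ρ x‖ ≤ M) : ‖x‖ ≤ M := by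
  let _ := CStarAlgebra.spectralOrder A
  let _ := CStarAlgebra.spectralOrderedRing A
  have hsx : IsSelfAdjoint (star x * x) := IsSelfAdjoint.star_mul_self x
  -- By the C*-identity, ‖x‖ ≤ M is the order statement x*x ≤ M²·1, to which a separation argument
  -- applies.
  suffices hle : star x * x ≤ algebraMap ℝ A (M ^ 2) by
    have h1 := (CStarAlgebra.norm_le_iff_le_algebraMap _ (sq_nonneg M)
      (star_mul_self_nonneg x)).2 hle
    rw [CStarRing.norm_star_mul_self, ← sq] at h1
    exact (abs_le_of_sq_le_sq' h1 hM).2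
  by_contra hnot
  rw [← sub_nonneg] at hnot
  -- The positive cone is closed and convex, so some f is nonnegative on it and negative at M²·1 -
  -- x*x.
  obtain ⟨f, hf, hf0⟩ := (ProperCone.positive ℝ A).hyperplane_separation_point hnot
  obtain ⟨φ, hφ⟩ := exists_positiveLinearMap (f : A →ₗ[ℝ] ℝ) hf
  have h1 := h φ.GNS φ.gnsStarAlgHom
  -- The cyclic vector satisfies ‖ξ‖² = f(1) and ‖xξ‖² = f(x*x). The bound ‖xξ‖ ≤ M‖ξ‖ thus gives
  -- f(M²·1 - x*x) ≥ 0, a contradiction.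
  let ξ : φ.GNS := (φ.toPreGNS 1 : φ.PreGNS)
  have hξ : ‖ξ‖ ^ 2 = f 1 := by
    have h2 := φ.preGNS_norm_sq (φ.toPreGNS 1)
    rw [PositiveLinearMap.ofPreGNS_toPreGNS, star_one, one_mul, hφ 1 (.one A)] at h2
    rw [UniformSpace.Completion.norm_coe]
    exact_mod_cast h2
  have hxξ : ‖φ.gnsStarAlgHom x ξ‖ ^ 2 = f (star x * x) := by
    have h2 := φ.preGNS_norm_sq (φ.leftMulMapPreGNS x (φ.toPreGNS 1))
    have h3 : φ.ofPreGNS (φ.leftMulMapPreGNS x (φ.toPreGNS 1)) = x := by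
      rw [PositiveLinearMap.leftMulMapPreGNS_apply]; simp
    rw [h3, hφ _ hsx] at h2
    have h4 : φ.gnsStarAlgHom x ξ =
        ((φ.leftMulMapPreGNS x (φ.toPreGNS 1) : φ.PreGNS) : φ.GNS) :=
      φ.gnsNonUnitalStarAlgHom_apply_coe
    rw [h4, UniformSpace.Completion.norm_coe]
    exact_mod_cast h2
  have h5 : ‖φ.gnsStarAlgHom x ξ‖ ≤ M * ‖ξ‖ :=
    ((φ.gnsStarAlgHom x).le_opNorm ξ).trans (mul_le_mul_of_nonneg_right h1 (norm_nonneg ξ))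
  have h6 : f (star x * x) ≤ M ^ 2 * f 1 := by
    rw [← hξ, ← hxξ, ← mul_pow]
    exact pow_le_pow_left₀ (norm_nonneg _) h5 2
  rw [map_sub, Algebra.algebraMap_eq_smul_one, map_smul, smul_eq_mul] at hf0
  linarith

end States

/-! ### Induced unitary representations -/

section Induced

/-- A unitary representation extends to the full group C*-algebra on a Hilbert space. -/
def GroupCStar.rep {Γ : Type u} [Group Γ] {E : Type u} [NormedAddCommGroup E]
    [InnerProductSpace ℂ E] [CompleteSpace E] (U : Γ →* (E →L[ℂ] E))
    (hU : ∀ g v, ‖U g v‖ = ‖v‖) : GroupCStar Γ →⋆ₐ[ℂ] (E →L[ℂ] E) :=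
  GroupCStar.lift U fun g => by
    rw [ContinuousLinearMap.star_eq_adjoint, ContinuousLinearMap.eq_adjoint_iff]
    intro x y
    -- An isometry preserves inner products, and U(g) has inverse U(g⁻¹); hence U(g⁻¹) is its
    -- adjoint.
    have h : inner ℂ (U g (U g⁻¹ x)) (U g y) = inner ℂ (U g⁻¹ x) y :=
      LinearIsometry.inner_map_map ⟨(U g).toLinearMap, hU g⟩ _ _
    rw [← h, ← mul_apply_eq_comp, ← map_mul, mul_inv_cancel, map_one,
      one_apply_eq_self]

variable {Γ : Type u} [Group Γ] (Λ : Subgroup Γ)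

/-- The cocycle `Γ × Γ/Λ → Λ` of a choice of coset representatives. -/
def cosetCocycle (g : Γ) (c : Γ ⧸ Λ) : Λ :=
  ⟨(g • c).out⁻¹ * (g * c.out), by
    rw [← QuotientGroup.eq, QuotientGroup.out_eq']
    conv_lhs => rw [← QuotientGroup.out_eq' c]
    rfl⟩

theorem cosetCocycle_one (c : Γ ⧸ Λ) : cosetCocycle Λ 1 c = 1 := by
  ext; simp [cosetCocycle]

/-- The two inner representatives of h • c cancel. This cocycle identity is what makes the induced
action multiplicative. -/
theorem cosetCocycle_mul (g h : Γ) (c : Γ ⧸ Λ) :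
    cosetCocycle Λ (g * h) c = cosetCocycle Λ g (h • c) * cosetCocycle Λ h c := by
  ext; simp [cosetCocycle, mul_smul, mul_assoc]

variable {Λ} {H : Type v} [NormedAddCommGroup H] [InnerProductSpace ℂ H]
  (σ : Λ →* (H →L[ℂ] H)) (hσ : ∀ g v, ‖σ g v‖ = ‖v‖)

/-- The Hilbert space of the representation of `Γ` induced from a representation of `Λ` on `H`. -/
abbrev IndSpace (Λ : Subgroup Γ) (H : Type v) [NormedAddCommGroup H] : Type (max u v) :=
  lp (fun _ : Γ ⧸ Λ => H) 2

/-- The operators of σ are isometric and c ↦ g⁻¹c permutes the cosets, so the squared norms are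
merely rearranged. This yields both square-summability and preservation of the norm for the induced
action. -/
theorem hasSum_induced (hσ : ∀ g v, ‖σ g v‖ = ‖v‖) (g : Γ) (ξ : IndSpace Λ H) :
    HasSum (fun c => ‖σ (cosetCocycle Λ g (g⁻¹ • c)) (ξ (g⁻¹ • c))‖ ^ (2 : ENNReal).toReal)
      (‖ξ‖ ^ (2 : ENNReal).toReal) := by
  simp only [hσ]
  exact (MulAction.toPerm (g⁻¹ : Γ) : Equiv.Perm (Γ ⧸ Λ)).hasSum_iff.2
    (lp.hasSum_norm (by norm_num) ξ)

/-- A group element, acting in the induced representation. -/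
def inducedIsometry (g : Γ) : IndSpace Λ H →ₗᵢ[ℂ] IndSpace Λ H where
  toFun ξ := ⟨fun c => σ (cosetCocycle Λ g (g⁻¹ • c)) (ξ (g⁻¹ • c)),
    memℓp_gen (hasSum_induced σ hσ g ξ).summable⟩
  map_add' ξ η := by
    ext c
    exact map_add _ _ _
  map_smul' a ξ := by
    ext c
    exact map_smul _ _ _
  norm_map' ξ := by
    have h1 := hasSum_induced σ hσ g ξ
    have h2 := (lp.hasSum_norm (p := 2) (by norm_num) (⟨_, memℓp_gen h1.summable⟩ :
      IndSpace Λ H)).unique h1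
    exact (Real.rpow_left_inj (norm_nonneg _) (norm_nonneg _) (by norm_num)).1 h2

theorem inducedIsometry_apply (g : Γ) (ξ : IndSpace Λ H) (c : Γ ⧸ Λ) :
    inducedIsometry σ hσ g ξ c = σ (cosetCocycle Λ g (g⁻¹ • c)) (ξ (g⁻¹ • c)) := rfl

/-- The representation of `Γ` induced from a unitary representation of `Λ`. -/
def inducedRep : Γ →* (IndSpace Λ H →L[ℂ] IndSpace Λ H) where
  toFun g := (inducedIsometry σ hσ g).toContinuousLinearMap
  map_one' := by
    ext ξ c
    change inducedIsometry σ hσ 1 ξ c = ξ c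
    rw [inducedIsometry_apply, cosetCocycle_one, map_one, inv_one, one_smul]
    rfl
  map_mul' g h := by
    ext ξ c
    change inducedIsometry σ hσ (g * h) ξ c =
      inducedIsometry σ hσ g (inducedIsometry σ hσ h ξ) c
    simp only [inducedIsometry_apply, cosetCocycle_mul, mul_inv_rev, mul_smul, smul_inv_smul,
      map_mul]
    rfl

theorem norm_inducedRep (g : Γ) (ξ : IndSpace Λ H) : ‖inducedRep σ hσ g ξ‖ = ‖ξ‖ :=
  (inducedIsometry σ hσ g).norm_map ξ

open Classical in
/-- In the induced representation, the vectors supported in a single coset are permuted. -/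
theorem inducedRep_single (g : Γ) (c : Γ ⧸ Λ) (v : H) :
    inducedRep σ hσ g (lp.single 2 c v) = lp.single 2 (g • c) (σ (cosetCocycle Λ g c) v) := by
  ext d
  change inducedIsometry σ hσ g (lp.single 2 c v) d = _
  rw [inducedIsometry_apply]
  by_cases h : d = g • c
  · subst h
    rw [inv_smul_smul, lp.single_apply_self, lp.single_apply_self]
  · rw [lp.single_apply_ne _ _ _ h, lp.single_apply_ne, map_zero]
    exact fun h' => h (by rw [← h', smul_inv_smul])

/-- The representative in `Λ` of the trivial coset of `Λ`. -/
def baseRep (Λ : Subgroup Γ) : Λ :=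
  ⟨((1 : Γ) : Γ ⧸ Λ).out, by
    have h := QuotientGroup.out_eq' ((1 : Γ) : Γ ⧸ Λ)
    rw [eq_comm, QuotientGroup.eq] at h
    simpa using h⟩

open Classical in
/-- A unitary representation of `Λ` is contained in the restriction to `Λ` of its induction. -/
theorem inducedRep_subgroup (h : Λ) (v : H) :
    inducedRep σ hσ h (lp.single 2 ((1 : Γ) : Γ ⧸ Λ) (σ (baseRep Λ)⁻¹ v)) =
      lp.single 2 ((1 : Γ) : Γ ⧸ Λ) (σ (baseRep Λ)⁻¹ (σ h v)) := by
  have h1 : (h : Γ) • ((1 : Γ) : Γ ⧸ Λ) = ((1 : Γ) : Γ ⧸ Λ) := by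
    change (((h : Γ) * 1 : Γ) : Γ ⧸ Λ) = _
    rw [eq_comm, QuotientGroup.eq]
    simp
  -- The chosen representative b = `baseRep Λ` of the trivial coset need not be 1, so on this coset
  -- Λ acts through h ↦ σ(b⁻¹hb). The twist by σ(b⁻¹) in the embedding v ↦ σ(b⁻¹)v makes it
  -- equivariant.
  have h2 : cosetCocycle Λ h ((1 : Γ) : Γ ⧸ Λ) = (baseRep Λ)⁻¹ * (h * baseRep Λ) := by
    ext
    simp [cosetCocycle, h1, baseRep]
  rw [inducedRep_single, h1, h2]
  congr 1
  simp only [← mul_apply_eq_comp, ← map_mul]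
  congr 2
  group

end Induced

/-! ### The inclusion of C*(Λ) in C*(Γ) for a subgroup Λ -/

section Subgroups

variable {Γ : Type u} [Group Γ]

/-- Continuous linear maps on `C*(Γ)` are determined by their values on `Γ`. -/
theorem GroupCStar.clm_ext {E : Type v} [NormedAddCommGroup E] [NormedSpace ℂ E]
    {f g : GroupCStar Γ →L[ℂ] E} (h : ∀ x, f (δ x) = g (δ x)) : f = g :=
  ContinuousLinearMap.ext_on (s := Set.range δ) dense_span (by rintro _ ⟨x, rfl⟩; exact h x)

/-- The continuous linear map underlying a *-homomorphism. -/
def homCLM {A : Type u} {B : Type v} [CStarAlgebra A] [CStarAlgebra B] (f : A →⋆ₐ[ℂ] B) :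
    A →L[ℂ] B := ⟨f.toAlgHom.toLinearMap, continuous_hom f⟩

/-- The orbit map of a vector under a representation. -/
def orbitCLM {A : Type u} {E : Type v} [CStarAlgebra A] [NormedAddCommGroup E]
    [InnerProductSpace ℂ E] [CompleteSpace E] (ρ : A →⋆ₐ[ℂ] (E →L[ℂ] E)) (v : E) : A →L[ℂ] E :=
  (ContinuousLinearMap.apply ℂ E v).comp (homCLM ρ)

theorem GroupCStar.norm_rep_δ {E : Type v} [NormedAddCommGroup E] [InnerProductSpace ℂ E]
    [CompleteSpace E] (ρ : GroupCStar Γ →⋆ₐ[ℂ] (E →L[ℂ] E)) (g : Γ) (v : E) :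
    ‖ρ (δ g) v‖ = ‖v‖ := by
  have h : ContinuousLinearMap.adjoint (ρ (δ g)) (ρ (δ g) v) = v := by
    rw [← ContinuousLinearMap.star_eq_adjoint, ← map_star, star_δ, ← mul_apply_eq_comp, ← map_mul,
      ← δ_mul, inv_mul_cancel, δ_one, map_one, one_apply_eq_self]
  have h2 : ‖ρ (δ g) v‖ ^ 2 = ‖v‖ ^ 2 := by
    have h3 : (inner ℂ (ρ (δ g) v) (ρ (δ g) v) : ℂ) = inner ℂ v v := by
      rw [← ContinuousLinearMap.adjoint_inner_right, h]
    rw [inner_self_eq_norm_sq_to_K, inner_self_eq_norm_sq_to_K] at h3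
    exact_mod_cast h3
  exact (pow_left_inj₀ (norm_nonneg _) (norm_nonneg _) two_ne_zero).1 h2

theorem GroupCStar.rep_δ {E : Type u} [NormedAddCommGroup E] [InnerProductSpace ℂ E]
    [CompleteSpace E] (U : Γ →* (E →L[ℂ] E)) (hU : ∀ g v, ‖U g v‖ = ‖v‖) (g : Γ) :
    rep U hU (δ g) = U g := lift_δ _ _ g

/-- For a subgroup `Λ` of a discrete group `Γ`, the canonical morphism `C*(Λ) → C*(Γ)` is
injective. -/
theorem GroupCStar.map_subtype_injective (Λ : Subgroup Γ) :
    Function.Injective (GroupCStar.map Λ.subtype) := by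
  classical
  rw [injective_iff_map_eq_zero]
  intro x hx
  rw [← norm_le_zero_iff]
  refine norm_le_of_forall_rep x le_rfl fun F _ _ _ ρ => ?_
  -- An arbitrary representation ρ of C*(Λ) is restricted to Λ and induced to a representation R of
  -- C*(Γ).
  let σ : Λ →* (F →L[ℂ] F) :=
    { toFun := fun h => ρ (δ h)
      map_one' := by rw [δ_one, map_one]
      map_mul' := fun g h => by rw [δ_mul, map_mul] }
  have hσ : ∀ g v, ‖σ g v‖ = ‖v‖ := GroupCStar.norm_rep_δ ρ
  let R := GroupCStar.rep (inducedRep σ hσ) (norm_inducedRep σ hσ)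
  -- The component of R at the trivial coset reproduces ρ up to the isometry σ(b⁻¹). Both sides are
  -- continuous and linear in x, so it is enough to compare them on Λ.
  have key : ∀ v, R (map Λ.subtype x) (lp.single 2 ((1 : Γ) : Γ ⧸ Λ) (σ (baseRep Λ)⁻¹ v))
      ((1 : Γ) : Γ ⧸ Λ) = σ (baseRep Λ)⁻¹ (ρ x v) := fun v => by
    have h := GroupCStar.clm_ext
      (f := (lp.evalCLM ℂ (fun _ : Γ ⧸ Λ => F) 2 ((1 : Γ) : Γ ⧸ Λ)).comp
        (orbitCLM (R.comp (map Λ.subtype)) (lp.single 2 ((1 : Γ) : Γ ⧸ Λ) (σ (baseRep Λ)⁻¹ v))))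
      (g := (σ (baseRep Λ)⁻¹).comp (orbitCLM ρ v)) fun h => by
        change R (map Λ.subtype (δ h)) (lp.single 2 ((1 : Γ) : Γ ⧸ Λ) (σ (baseRep Λ)⁻¹ v))
          ((1 : Γ) : Γ ⧸ Λ) = σ (baseRep Λ)⁻¹ (σ h v)
        rw [map_δ, GroupCStar.rep_δ]
        refine (congrArg (fun ξ : IndSpace Λ F => ξ ((1 : Γ) : Γ ⧸ Λ))
          (inducedRep_subgroup σ hσ h v)).trans ?_
        exact lp.single_apply_self _ _ _
    exact DFunLike.congr_fun h x
  have h0 : ρ x = 0 := by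
    ext v
    have h1 := key v
    rw [hx, map_zero] at h1
    have h2 := hσ (baseRep Λ)⁻¹ (ρ x v)
    rw [← h1] at h2
    rw [zero_apply, ← norm_eq_zero, ← h2]
    exact norm_zero
  rw [h0, norm_zero]

/-- An element of `Γ` whose unitary belongs to `C*(Λ) ⊂ C*(Γ)` is an element of `Λ`. -/
theorem GroupCStar.mem_of_δ_mem_ofSubgroup {Λ : Subgroup Γ} {g : Γ} (hg : δ g ∈ ofSubgroup Λ) :
    g ∈ Λ := by
  classical
  by_contra hn
  -- Inducing the trivial representation gives the action of Γ on ℓ²(Γ/Λ).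
  let σ : Λ →* (ℂ →L[ℂ] ℂ) := 1
  have hσ : ∀ g v, ‖σ g v‖ = ‖v‖ := fun _ _ => rfl
  let R := GroupCStar.rep (inducedRep σ hσ) (norm_inducedRep σ hσ)
  have hne : g • ((1 : Γ) : Γ ⧸ Λ) ≠ ((1 : Γ) : Γ ⧸ Λ) := by
    change (((g : Γ) * 1 : Γ) : Γ ⧸ Λ) ≠ _
    rw [ne_comm, Ne, QuotientGroup.eq]
    simpa using hn
  obtain ⟨y, hy⟩ := hg
  -- Elements of Λ fix the basis vector of the trivial coset, so every element of C*(Λ) sends it to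
  -- a vector with zero coefficient at gΛ ≠ Λ.
  have h := GroupCStar.clm_ext
      (f := (lp.evalCLM ℂ (fun _ : Γ ⧸ Λ => ℂ) 2 (g • ((1 : Γ) : Γ ⧸ Λ))).comp
        (orbitCLM (R.comp (map Λ.subtype)) (lp.single 2 ((1 : Γ) : Γ ⧸ Λ) 1)))
      (g := 0) fun h => by
        change R (map Λ.subtype (δ h)) (lp.single 2 ((1 : Γ) : Γ ⧸ Λ) 1)
          (g • ((1 : Γ) : Γ ⧸ Λ)) = 0
        rw [map_δ, GroupCStar.rep_δ]
        refine (congrArg (fun ξ : IndSpace Λ ℂ => ξ (g • ((1 : Γ) : Γ ⧸ Λ)))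
          (inducedRep_subgroup σ hσ h 1)).trans ?_
        exact lp.single_apply_ne _ _ _ hne
  have h1 : R (map Λ.subtype y) (lp.single 2 ((1 : Γ) : Γ ⧸ Λ) 1) (g • ((1 : Γ) : Γ ⧸ Λ)) = 0 :=
    DFunLike.congr_fun h y
  -- The unitary of g moves that basis vector to the one of gΛ, so the same coefficient equals 1.
  rw [show map Λ.subtype y = δ g from hy, GroupCStar.rep_δ, inducedRep_single,
    lp.single_apply_self] at h1
  exact one_ne_zero h1

end Subgroups

/-! ### The matrix JDJ* and the algebra generated by its last rows -/

section DualSubgroups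

open GroupCStar QuantumSubgroup

variable {Γ : Type u} [Group Γ] {n : ℕ}

/-- An injective *-homomorphism of C*-algebras is isometric, so its range is complete. -/
theorem GroupCStar.isClosed_ofSubgroup (Λ : Subgroup Γ) :
    IsClosed (ofSubgroup Λ : Set (GroupCStar Γ)) := by
  have h := (NonUnitalStarAlgHom.isometry (map Λ.subtype)
    (map_subtype_injective Λ)).isClosedEmbedding.isClosed_range
  have : (ofSubgroup Λ : Set (GroupCStar Γ)) = Set.range (map Λ.subtype) := by
    ext x; rfl
  rwa [this]

theorem GroupCStar.δ_mem_ofSubgroup {Λ : Subgroup Γ} {g : Γ} (hg : g ∈ Λ) : δ g ∈ ofSubgroup Λ :=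
  ⟨δ ⟨g, hg⟩, map_δ _ _⟩

theorem GroupCStar.δ_mem_ofSubgroup_iff {Λ : Subgroup Γ} {g : Γ} : δ g ∈ ofSubgroup Λ ↔ g ∈ Λ :=
  ⟨mem_of_δ_mem_ofSubgroup, δ_mem_ofSubgroup⟩

/-- The subgroup is recovered as the set of g whose unitary lies in the subalgebra. -/
theorem GroupCStar.ofSubgroup_injective :
    Function.Injective (ofSubgroup : Subgroup Γ → StarSubalgebra ℂ (GroupCStar Γ)) := by
  intro Λ Λ' h
  ext g
  rw [← δ_mem_ofSubgroup_iff, h, δ_mem_ofSubgroup_iff]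

/-- A closed *-subalgebra of `C*(Γ)` containing `Λ` contains `C*(Λ)`. -/
theorem GroupCStar.ofSubgroup_le {Λ : Subgroup Γ} {S : StarSubalgebra ℂ (GroupCStar Γ)}
    (hS : IsClosed (S : Set (GroupCStar Γ))) (h : ∀ g ∈ Λ, δ g ∈ S) : ofSubgroup Λ ≤ S := by
  rintro _ ⟨y, rfl⟩
  change map Λ.subtype y ∈ S
  have hcl : IsClosed ((map Λ.subtype) ⁻¹' (S : Set (GroupCStar Γ))) :=
    hS.preimage (continuous_hom _)
  -- The preimage of S is closed, so it suffices that it contains the dense span of Λ in C*(Λ).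
  refine hcl.closure_subset_iff.2 ?_ (dense_span y)
  have : Submodule.span ℂ (Set.range (δ : Λ → GroupCStar Λ)) ≤
      Subalgebra.toSubmodule (S.comap (map Λ.subtype)).toSubalgebra := by
    rw [Submodule.span_le]
    rintro _ ⟨x, rfl⟩
    change map Λ.subtype (δ x) ∈ S
    rw [map_δ]
    exact h x x.2
  exact fun z hz => this hz

theorem dual_proj_gen (g : Fin n → Γ) (hg : Subgroup.closure (Set.range g) = ⊤)
    (J : Matrix.unitaryGroup (Fin n) ℂ) (i j : Fin n) :
    (dual g hg J).proj (UPlus.gen n i j) = dualMatrix g J i j :=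
  UPlus.lift_gen _ (isBiunitary_dualMatrix g J) i j

/-- The scalars J_ir and conj(J_jr) are central. A general f is allowed because the formula is
needed for the identity, for C*(Γ) → C*(Γ/N) and for the morphism onto C(G ∩ H). -/
theorem map_dualMatrix_apply {A : Type u} [CStarAlgebra A] (f : GroupCStar Γ →⋆ₐ[ℂ] A)
    (g : Fin n → Γ) (J : Matrix.unitaryGroup (Fin n) ℂ) (i j : Fin n) :
    f (dualMatrix g J i j) = ∑ r, (J.val i r * star (J.val j r)) • f (δ (g r)) := by
  have h := congrFun (congrFun (dualMatrix_map f g J) i) j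
  rw [Matrix.map_apply] at h
  rw [h, Matrix.mul_apply]
  refine Finset.sum_congr rfl fun r _ => ?_
  simp only [scalarMatrix, Matrix.mul_diagonal, Matrix.map_apply, Matrix.star_apply]
  rw [mul_assoc, ← Algebra.commutes, ← mul_assoc, ← map_mul, ← Algebra.smul_def]

theorem dualMatrix_apply (g : Fin n → Γ) (J : Matrix.unitaryGroup (Fin n) ℂ) (i j : Fin n) :
    dualMatrix g J i j = ∑ r, (J.val i r * star (J.val j r)) • δ (g r) :=
  map_dualMatrix_apply (StarAlgHom.id ℂ _) g J i j

theorem sum_row_mul_star (J : Matrix.unitaryGroup (Fin n) ℂ) (i j : Fin n) :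
    ∑ r, J.val i r * star (J.val j r) = if i = j then 1 else 0 := by
  have h := congrFun (congrFun J.2.2 i) j
  rw [Matrix.mul_apply, Matrix.one_apply] at h
  exact h

theorem sum_star_mul_col (J : Matrix.unitaryGroup (Fin n) ℂ) (r s : Fin n) :
    ∑ j, star (J.val j r) * J.val j s = if r = s then 1 else 0 := by
  have h := congrFun (congrFun J.2.1 r) s
  rw [Matrix.mul_apply, Matrix.one_apply] at h
  exact h

/-- The entries of `J D` are recovered from those of `J D J*`. -/
theorem sum_dualMatrix_smul {A : Type u} [CStarAlgebra A] (f : GroupCStar Γ →⋆ₐ[ℂ] A)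
    (g : Fin n → Γ) (J : Matrix.unitaryGroup (Fin n) ℂ) (i s : Fin n) :
    ∑ j, J.val j s • f (dualMatrix g J i j) = J.val i s • f (δ (g s)) := by
  simp only [map_dualMatrix_apply, Finset.smul_sum, smul_smul]
  rw [Finset.sum_comm]
  have h : ∀ r, ∑ j, (J.val j s * (J.val i r * star (J.val j r))) • f (δ (g r)) =
      if r = s then J.val i s • f (δ (g s)) else 0 := by
    intro r
    rw [← Finset.sum_smul]
    -- Summing over j first leaves the inner product of the columns r and s of J, which is the entry
    -- (J*J)_rs.
    have h1 : ∑ j, J.val j s * (J.val i r * star (J.val j r)) =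
        J.val i r * ∑ j, star (J.val j r) * J.val j s := by
      rw [Finset.mul_sum]
      exact Finset.sum_congr rfl fun j _ => by ring
    rw [h1, sum_star_mul_col]
    split_ifs with hrs
    · subst hrs; rw [mul_one]
    · rw [mul_zero, zero_smul]
  rw [Finset.sum_congr rfl fun r _ => h r, Finset.sum_ite_eq']
  exact if_pos (Finset.mem_univ s)

/-- The i-th row of (JDJ*)J = JD has the entry J_ir g_r, and one may divide by J_ir. A single row of
u therefore already contains g_r in its span. -/
theorem δ_mem_of_row {g : Fin n → Γ} {J : Matrix.unitaryGroup (Fin n) ℂ} {i r : Fin n}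
    (h : J.val i r ≠ 0) {S : StarSubalgebra ℂ (GroupCStar Γ)}
    (hS : ∀ j, dualMatrix g J i j ∈ S) : δ (g r) ∈ S := by
  have h1 : ∑ j, J.val j r • dualMatrix g J i j = J.val i r • δ (g r) :=
    sum_dualMatrix_smul (StarAlgHom.id ℂ (GroupCStar Γ)) g J i r
  have h2 : δ (g r) = (J.val i r)⁻¹ • ∑ j, J.val j r • dualMatrix g J i j := by
    rw [h1, smul_smul, inv_mul_cancel₀ h, one_smul]
  rw [h2]
  exact SMulMemClass.smul_mem _ (sum_mem fun j _ => SMulMemClass.smul_mem _ (hS j))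

/-- `C_×(G/H) = C*(Λ)` for a group dual `G`. -/
theorem rowAlgebra_dual (g : Fin n → Γ) (hg : Subgroup.closure (Set.range g) = ⊤)
    (J : Matrix.unitaryGroup (Fin n) ℂ) (k : ℕ) :
    (dual g hg J).rowAlgebra k = ofSubgroup (Subgroup.closure (rowSet g J k)) := by
  have hset : {x : GroupCStar Γ | ∃ i j : Fin n, k ≤ i.val ∧
      x = (dual g hg J).proj (UPlus.gen n i j)} =
      {x | ∃ i j : Fin n, k ≤ i.val ∧ x = dualMatrix g J i j} := by
    simp only [dual_proj_gen]
  refine (congrArg (fun S : Set (GroupCStar Γ) =>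
    (StarAlgebra.adjoin ℂ S).topologicalClosure) hset).trans ?_
  apply le_antisymm
  · refine StarSubalgebra.topologicalClosure_minimal (StarAlgebra.adjoin_le ?_)
      (isClosed_ofSubgroup _)
    rintro _ ⟨i, j, hi, rfl⟩
    change dualMatrix g J i j ∈ ofSubgroup _
    rw [dualMatrix_apply]
    refine sum_mem fun r _ => ?_
    -- Only the r with J_ir ≠ 0 contribute to u_ij, and for i > k these g_r are generators of Λ.
    by_cases h : J.val i r = 0
    · rw [h, zero_mul, zero_smul]; exact zero_mem _
    · exact SMulMemClass.smul_mem _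
        (δ_mem_ofSubgroup (Subgroup.subset_closure ⟨r, ⟨i, hi, h⟩, rfl⟩))
  · refine ofSubgroup_le (StarSubalgebra.isClosed_topologicalClosure _) fun x hx => ?_
    induction hx using Subgroup.closure_induction with
    | mem x hx =>
      obtain ⟨r, ⟨i, hi, h⟩, rfl⟩ := hx
      refine StarSubalgebra.le_topologicalClosure _ (δ_mem_of_row h fun j => ?_)
      exact StarAlgebra.subset_adjoin ℂ _ ⟨i, j, hi, rfl⟩
    | one => rw [δ_one]; exact one_mem _
    | mul x y _ _ hx hy => rw [δ_mul]; exact mul_mem hx hy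
    | inv x _ hx => rw [← star_δ]; exact star_mem hx

end DualSubgroups

/-! ### The intersection with U_k⁺ as the dual of a quotient group -/

section Intersection

open GroupCStar QuantumSubgroup

variable {n k : ℕ}

theorem MinTensor.map_map {A B A' B' A'' B'' : Type u} [CStarAlgebra A] [CStarAlgebra B]
    [CStarAlgebra A'] [CStarAlgebra B'] [CStarAlgebra A''] [CStarAlgebra B'']
    (f : A →⋆ₐ[ℂ] A') (g : B →⋆ₐ[ℂ] B') (f' : A' →⋆ₐ[ℂ] A'') (g' : B' →⋆ₐ[ℂ] B'')
    (x : MinTensor A B) : map f' g' (map f g x) = map (f'.comp f) (g'.comp g) x := by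
  have h : (map f' g').comp (map f g) = map (f'.comp f) (g'.comp g) :=
    MinTensor.hom_ext fun a b => by
      rw [StarAlgHom.comp_apply, map_tmul, map_tmul, map_tmul]; rfl
  exact DFunLike.congr_fun h x

/-- Quantum subgroups of `U_n⁺` with the same kernel are isomorphic. -/
theorem QuantumSubgroup.isomorphic_of_ker_eq {K L : QuantumSubgroup.{u} n}
    (h : RingHom.ker K.proj = RingHom.ker L.proj) : K.Isomorphic L := by
  let a := factor K.proj K.surjective L.proj h.le
  let b := factor L.proj L.surjective K.proj h.ge
  have ha : ∀ x, a (K.proj x) = L.proj x := factor_apply _ _ _ _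
  have hb : ∀ x, b (L.proj x) = K.proj x := factor_apply _ _ _ _
  let θ : K.carrier ≃⋆ₐ[ℂ] L.carrier := StarAlgEquiv.ofStarAlgHom a b
    (by
      ext y; obtain ⟨x, rfl⟩ := K.surjective y
      change b (a (K.proj x)) = K.proj x
      rw [ha, hb])
    (by
      ext y; obtain ⟨x, rfl⟩ := L.surjective y
      change a (b (L.proj x)) = L.proj x
      rw [hb, ha])
  have hθ : ∀ x, θ (K.proj x) = L.proj x := ha
  refine ⟨θ, fun y => ?_, hθ⟩
  obtain ⟨x, rfl⟩ := K.surjective y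
  -- Both comultiplications are determined by the one of C(U_n⁺), so θ intertwines them as soon as
  -- it intertwines the projections.
  rw [hθ, L.comul_proj, K.comul_proj, MinTensor.map_map]
  congr 2 <;> · ext x; exact (hθ x).symm

theorem blockDiag_apply_of_le {A : Type u} [CStarAlgebra A] (hk : k ≤ n)
    (v : Matrix (Fin k) (Fin k) A) {i j : Fin n} (h : k ≤ i.val ∨ k ≤ j.val) :
    blockDiag hk v i j = (1 : Matrix (Fin n) (Fin n) A) i j := by
  obtain ⟨a, rfl⟩ := (blockEquiv hk).surjective i
  obtain ⟨b, rfl⟩ := (blockEquiv hk).surjective j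
  simp only [blockDiag, Matrix.reindex_apply, Matrix.submatrix_apply, Equiv.symm_apply_apply,
    Matrix.one_apply, (blockEquiv hk).injective.eq_iff]
  rcases a with a | a <;> rcases b with b | b
  -- Two indices in the first block are both below k, against the hypothesis.
  · simp [blockEquiv] at h; omega
  · simp
  · simp
  · simp [Matrix.one_apply]

/-- A matrix which agrees with the identity outside the upper left corner is of the form
`diag(v, 1)`. -/
theorem eq_blockDiag {A : Type u} [CStarAlgebra A] (hk : k ≤ n) {w : Matrix (Fin n) (Fin n) A}
    (h : ∀ i j : Fin n, k ≤ i.val ∨ k ≤ j.val → w i j = (1 : Matrix (Fin n) (Fin n) A) i j) :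
    w = blockDiag hk (fun i j => w (Fin.castLE hk i) (Fin.castLE hk j)) := by
  ext i j
  by_cases hij : k ≤ i.val ∨ k ≤ j.val
  · exact (h i j hij).trans (blockDiag_apply_of_le hk _ hij).symm
  · push Not at hij
    exact (blockDiag_apply hk (fun i j => w (Fin.castLE hk i) (Fin.castLE hk j))
      ⟨i, hij.1⟩ ⟨j, hij.2⟩).symm

/-- The map v ↦ diag(v, 1) is injective, sends 1 to 1 and respects products, adjoints and
transposes, so the four unitarity relations descend to v. -/
theorem isBiunitary_of_blockDiag {A : Type u} [CStarAlgebra A] (hk : k ≤ n)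
    {v : Matrix (Fin k) (Fin k) A} (h : IsBiunitary (blockDiag hk v)) : IsBiunitary v := by
  have key : ∀ a : Matrix (Fin k) (Fin k) A, blockDiag hk a = 1 → a = 1 := by
    intro a ha
    ext i j
    rw [← blockDiag_apply hk a i j, ha, Matrix.one_apply, Matrix.one_apply]
    simp [Fin.ext_iff]
  obtain ⟨⟨h1, h2⟩, h3, h4⟩ := h
  rw [blockDiag_transpose] at h3 h4
  rw [blockDiag_star, blockDiag_mul] at h1 h2 h3 h4
  exact ⟨⟨key _ h1, key _ h2⟩, key _ h3, key _ h4⟩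

theorem uPlusSubgroup_proj_gen (hk : k ≤ n) (i j : Fin n) :
    (uPlusSubgroup.{u} hk).proj (UPlus.gen n i j) = blockDiag hk (UPlus.gen k) i j :=
  UPlus.lift_gen _ (isBiunitary_blockDiag hk UPlus.isBiunitary_gen) i j

/-- A morphism from `C(U_n⁺)` vanishes on the kernel of `C(U_n⁺) → C(U_k⁺)` if and only if it maps
`u` to a matrix of the form `diag(v, 1)`. -/
theorem ker_uPlusSubgroup_le_iff {A : Type u} [CStarAlgebra A] (hk : k ≤ n)
    (f : UPlus.{u} n →⋆ₐ[ℂ] A) :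
    RingHom.ker (uPlusSubgroup hk).proj ≤ RingHom.ker f ↔
      ∀ i j : Fin n, k ≤ i.val ∨ k ≤ j.val →
        f (UPlus.gen n i j) = (1 : Matrix (Fin n) (Fin n) A) i j := by
  constructor
  · intro h i j hij
    rw [← factor_apply _ (uPlusSubgroup hk).surjective f h, uPlusSubgroup_proj_gen]
    refine (congrArg _ (blockDiag_apply_of_le hk (UPlus.gen k) hij)).trans ?_
    rw [Matrix.one_apply, Matrix.one_apply]
    split_ifs
    · exact map_one _
    · exact map_zero _
  · intro h
    -- The image of u is diag(v, 1) with v biunitary, so the universal property of C(U_k⁺) gives a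
    -- morphism through which f factors.
    have hw := eq_blockDiag hk (w := (UPlus.gen n).map f) h
    have hv := isBiunitary_of_blockDiag hk (hw ▸ UPlus.isBiunitary_gen.map f)
    have hf : f = (UPlus.lift _ hv).comp (uPlusSubgroup hk).proj := by
      refine UPlus.hom_ext fun i j => ?_
      change _ = UPlus.lift _ hv ((uPlusSubgroup hk).proj (UPlus.gen n i j))
      rw [uPlusSubgroup_proj_gen]
      refine (congrFun (congrFun hw i) j).trans ?_
      have hm := congrFun (congrFun (blockDiag_map hk (UPlus.gen k) (UPlus.lift _ hv)) i) j
      refine Eq.trans ?_ hm.symm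
      congr 1
      ext a b
      exact (UPlus.lift_gen _ hv a b).symm
    intro x hx
    rw [RingHom.mem_ker, hf]
    exact (congrArg (UPlus.lift _ hv) ((RingHom.mem_ker).1 hx)).trans (map_zero _)

variable {Γ : Type u} [Group Γ]

/-- A morphism from `C*(Γ)` maps `J D J*` to a matrix of the form `diag(v, 1)` if and only if it
maps the distinguished generators to `1`. -/
theorem map_dualMatrix_eq_one_iff {A : Type u} [CStarAlgebra A] (f : GroupCStar Γ →⋆ₐ[ℂ] A)
    (g : Fin n → Γ) (J : Matrix.unitaryGroup (Fin n) ℂ) :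
    (∀ i j : Fin n, k ≤ i.val ∨ k ≤ j.val →
        f (dualMatrix g J i j) = (1 : Matrix (Fin n) (Fin n) A) i j) ↔
      ∀ x ∈ rowSet g J k, f (δ x) = 1 := by
  constructor
  · rintro h _ ⟨r, ⟨i, hi, hr⟩, rfl⟩
    -- Only the row condition is used: if the i-th row of f(u) is that of the identity, multiplying
    -- by J on the right gives J_ir = J_ir f(g_r).
    have h1 := sum_dualMatrix_smul f g J i r
    simp only [h i _ (.inl hi)] at h1
    simp only [Matrix.one_apply, smul_ite, smul_zero, Finset.sum_ite_eq, Finset.mem_univ,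
      if_true] at h1
    have h2 := congrArg ((J.val i r)⁻¹ • ·) h1
    simp only [smul_smul, inv_mul_cancel₀ hr, one_smul] at h2
    exact h2.symm
  · intro h i j hij
    rw [map_dualMatrix_apply]
    -- Each term either has a zero coefficient or has f(g_r) = 1. The second case covers columns j >
    -- k too, because the coefficient contains conj(J_jr). What remains is (JJ*)_ij.
    have h1 : ∀ r, (J.val i r * star (J.val j r)) • f (δ (g r)) =
        (J.val i r * star (J.val j r)) • (1 : A) := by
      intro r
      rcases hij with hi | hj
      · by_cases hr : J.val i r = 0
        · rw [hr, zero_mul, zero_smul, zero_smul]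
        · rw [h _ ⟨r, ⟨i, hi, hr⟩, rfl⟩]
      · by_cases hr : J.val j r = 0
        · rw [hr, star_zero, mul_zero, zero_smul, zero_smul]
        · rw [h _ ⟨r, ⟨j, hj, hr⟩, rfl⟩]
    simp only [h1]
    rw [← Finset.sum_smul, sum_row_mul_star, Matrix.one_apply]
    split_ifs
    · exact one_smul _ _
    · exact zero_smul _ _

/-- Both morphisms send u to JDJ* over C*(Γ/N), and they are determined by the image of u. -/
theorem dual_quotient_proj (g : Fin n → Γ) (hg : Subgroup.closure (Set.range g) = ⊤)
    (J : Matrix.unitaryGroup (Fin n) ℂ) (N : Subgroup Γ) [N.Normal] (x : UPlus.{u} n) :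
    (dual (fun r => (QuotientGroup.mk (g r) : Γ ⧸ N)) (closure_range_mk hg N) J).proj x =
      map (QuotientGroup.mk' N) ((dual g hg J).proj x) := by
  have h : (dual (fun r => (QuotientGroup.mk (g r) : Γ ⧸ N)) (closure_range_mk hg N) J).proj =
      (map (QuotientGroup.mk' N)).comp (dual g hg J).proj := by
    refine UPlus.hom_ext fun i j => ?_
    change _ = map (QuotientGroup.mk' N) ((dual g hg J).proj (UPlus.gen n i j))
    rw [dual_proj_gen, dual_proj_gen]
    refine (dualMatrix_apply _ J i j).trans ((map_dualMatrix_apply _ g J i j).trans ?_).symm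
    simp only [map_δ]
    rfl
  exact DFunLike.congr_fun h x

/-- A morphism from `C*(Γ)` which is trivial on `S` factors through `C*(Γ/⟨⟨S⟩⟩)`. -/
theorem GroupCStar.ker_map_mk_le {A : Type u} [CStarAlgebra A] {S : Set Γ}
    (f : GroupCStar Γ →⋆ₐ[ℂ] A) (h : ∀ x ∈ S, f (δ x) = 1) :
    RingHom.ker (map (QuotientGroup.mk' (Subgroup.normalClosure S))) ≤ RingHom.ker f := by
  let φ : Γ →* A :=
    { toFun := fun x => f (δ x)
      map_one' := by rw [δ_one, map_one]
      map_mul' := fun x y => by rw [δ_mul, map_mul] }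
  -- The elements on which f is 1 form a normal subgroup containing S, so the representation of Γ
  -- descends to the quotient.
  have hφ : Subgroup.normalClosure S ≤ φ.ker := Subgroup.normalClosure_le_normal h
  have hs : ∀ x : Γ ⧸ Subgroup.normalClosure S, QuotientGroup.lift _ φ hφ x⁻¹ =
      star (QuotientGroup.lift _ φ hφ x) := by
    intro x
    obtain ⟨x, rfl⟩ := QuotientGroup.mk'_surjective _ x
    rw [← map_inv]
    change f (δ x⁻¹) = star (f (δ x))
    rw [← map_star, star_δ]
  have hf : f = (GroupCStar.lift (QuotientGroup.lift _ φ hφ) hs).comp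
      (map (QuotientGroup.mk' (Subgroup.normalClosure S))) := by
    refine GroupCStar.hom_ext fun x => ?_
    rw [StarAlgHom.comp_apply, map_δ, lift_δ]
    rfl
  intro x hx
  rw [RingHom.mem_ker, hf, StarAlgHom.comp_apply, (RingHom.mem_ker).1 hx, map_zero]

/-- The intersection of a group dual with `U_k⁺` is the dual of a quotient group. -/
theorem inter_uPlusSubgroup_isomorphic (hk : k ≤ n) (g : Fin n → Γ)
    (hg : Subgroup.closure (Set.range g) = ⊤) (J : Matrix.unitaryGroup (Fin n) ℂ) :
    ((dual g hg J).inter (uPlusSubgroup hk)).Isomorphic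
      (dual (fun r => (QuotientGroup.mk (g r) : Γ ⧸ Subgroup.normalClosure (rowSet g J k)))
        (closure_range_mk hg (Subgroup.normalClosure (rowSet g J k))) J) := by
  set N := Subgroup.normalClosure (rowSet g J k)
  set G := dual g hg J
  set L := dual (fun r => (QuotientGroup.mk (g r) : Γ ⧸ N)) (closure_range_mk hg N) J
  have hL : ∀ x, L.proj x = map (QuotientGroup.mk' N) (G.proj x) := dual_quotient_proj g hg J N
  -- The kernel of the intersection is the sum of the two kernels, so one inclusion says that
  -- C(U_n⁺) → C*(Γ/N) factors through both C*(Γ) and C(U_k⁺).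
  apply isomorphic_of_ker_eq
  apply le_antisymm
  · rw [ker_inter_proj]
    refine sup_le (fun x hx => ?_) ((ker_uPlusSubgroup_le_iff hk _).2 fun i j hij => ?_)
    · rw [RingHom.mem_ker, hL, (RingHom.mem_ker).1 hx]
      exact map_zero (map (QuotientGroup.mk' N))
    · rw [hL, dual_proj_gen]
      refine (map_dualMatrix_eq_one_iff (map (QuotientGroup.mk' N)) g J).2 (fun x hx => ?_) i j hij
      rw [map_δ, show QuotientGroup.mk' N x = 1 from
        (QuotientGroup.eq_one_iff x).2 (Subgroup.subset_normalClosure hx), δ_one]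
  · set K := G.inter (uPlusSubgroup hk)
    have hG : RingHom.ker G.proj ≤ RingHom.ker K.proj := inter_isSubgroup_left _ _
    have hU : RingHom.ker (uPlusSubgroup hk).proj ≤ RingHom.ker K.proj := by
      rw [ker_inter_proj]; exact le_sup_right
    -- For the other inclusion, the morphism onto C(G ∩ H) factors through C*(Γ). It kills the
    -- kernel for U_k⁺, which forces q to be 1 on `rowSet` and hence to factor through C*(Γ/N).
    let q : GroupCStar Γ →⋆ₐ[ℂ] K.carrier := factor G.proj G.surjective K.proj hG
    have hq : ∀ x, q (G.proj x) = K.proj x := factor_apply _ _ _ _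
    have h1 : ∀ x ∈ rowSet g J k, q (δ x) = 1 := by
      refine (map_dualMatrix_eq_one_iff q g J).1 fun i j hij => ?_
      rw [← dual_proj_gen g hg J, hq]
      exact (ker_uPlusSubgroup_le_iff hk K.proj).1 hU i j hij
    intro x hx
    rw [RingHom.mem_ker, ← hq]
    exact ker_map_mk_le q h1 ((hL x).symm.trans hx)

end Intersection

/-! ### The fixed point algebra of the coaction of C*(Γ/N) -/

section Quotient

open GroupCStar QuantumSubgroup

/-! ### The regular representation and the canonical trace -/

section Regular

variable (Θ : Type u) [Group Θ]

/-- The trivial representation of the trivial subgroup. -/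
def trivialRep : (⊥ : Subgroup Θ) →* (ℂ →L[ℂ] ℂ) := 1

theorem norm_trivialRep (g : (⊥ : Subgroup Θ)) (v : ℂ) : ‖trivialRep Θ g v‖ = ‖v‖ := rfl

/-- The Hilbert space of the regular representation of `Θ`. -/
abbrev RegSpace : Type u := IndSpace (⊥ : Subgroup Θ) ℂ

open Classical in
/-- The cyclic vector of the regular representation. -/
def regVec : RegSpace Θ := lp.single 2 ((1 : Θ) : Θ ⧸ (⊥ : Subgroup Θ)) (1 : ℂ)

/-- The regular representation of `C*(Θ)`. -/
def regRep : GroupCStar Θ →⋆ₐ[ℂ] (RegSpace Θ →L[ℂ] RegSpace Θ) :=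
  GroupCStar.rep (inducedRep (trivialRep Θ) (norm_trivialRep Θ))
    (norm_inducedRep _ (norm_trivialRep Θ))

theorem norm_regVec : ‖regVec Θ‖ = 1 := by
  classical
  rw [regVec, lp.norm_single (by norm_num), norm_one]

open Classical in
variable {Θ} in
/-- The vector state of the regular representation is the canonical trace. -/
theorem inner_regRep (q : Θ) :
    inner ℂ (regVec Θ) (regRep Θ (δ q) (regVec Θ)) = if q = 1 then (1 : ℂ) else 0 := by
  have h : ((1 : Θ) : Θ ⧸ (⊥ : Subgroup Θ)) = q • ((1 : Θ) : Θ ⧸ (⊥ : Subgroup Θ)) ↔ q = 1 := by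
    change _ = ((q * 1 : Θ) : Θ ⧸ (⊥ : Subgroup Θ)) ↔ _
    rw [QuotientGroup.eq]
    simp
  rw [regRep, GroupCStar.rep_δ, regVec, inducedRep_single, lp.inner_single_left]
  split_ifs with hq
  · rw [← h.2 hq, lp.single_apply_self, trivialRep]
    simp
  · rw [lp.single_apply_ne _ _ _ (h.not.2 hq), inner_zero_right]

end Regular

/-- The norm of the minimal tensor product dominates the slices of an algebraic tensor by a unit
vector. -/
theorem norm_le_of_slice {A B : Type u} [CStarAlgebra A] [CStarAlgebra B] {E : Type u}
    [NormedAddCommGroup E] [InnerProductSpace ℂ E] [CompleteSpace E] (π : A →⋆ₐ[ℂ] (E →L[ℂ] E))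
    {v : E} (hv : ‖v‖ = 1) (y : A ⊗[ℂ] B) (b : B)
    (h : ∀ (F : Type u) [NormedAddCommGroup F] [InnerProductSpace ℂ F] [CompleteSpace F]
      (ρ : B →⋆ₐ[ℂ] (F →L[ℂ] F)) (ξ η : F),
      inner ℂ (v ⊗ₜ[ℂ] ξ) (spatialRep π ρ y (v ⊗ₜ[ℂ] η)) = inner ℂ ξ (ρ b η)) :
    ‖b‖ ≤ ‖MinTensor.of A B y‖ := by
  refine norm_le_of_forall_rep b (norm_nonneg _) fun F _ _ _ ρ => ?_
  have h1 : ‖spatialRep π ρ y‖ ≤ ‖MinTensor.of A B y‖ := by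
    refine le_of_le_of_eq ?_ ((minSeminorm A B).norm_of y).symm
    exact CStarSeminorm.le_sup (S := spatialSeminorms A B) (hS := bddAbove_spatialSeminorms A B)
      (p := spatialSeminorm π ρ) ⟨E, F, _, _, _, _, _, _, π, ρ, rfl⟩ y
  refine ContinuousLinearMap.opNorm_le_bound _ (norm_nonneg _) fun η => ?_
  have hn : ∀ ζ : F, ‖v ⊗ₜ[ℂ] ζ‖ = ‖ζ‖ := fun ζ => by
    rw [TensorProduct.norm_tmul, hv, one_mul]
  have h3 : ‖spatialRep π ρ y (v ⊗ₜ[ℂ] η)‖ ≤ ‖MinTensor.of A B y‖ * ‖η‖ := by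
    refine (ContinuousLinearMap.le_opNorm _ _).trans ?_
    rw [hn]
    exact mul_le_mul_of_nonneg_right h1 (norm_nonneg η)
  have hcs : ∀ a c : E ⊗[ℂ] F, ‖(inner ℂ a c : ℂ)‖ ≤ ‖a‖ * ‖c‖ := fun a c =>
    norm_inner_le_norm a c
  have h4 : ‖(inner ℂ (ρ b η) (ρ b η) : ℂ)‖ = ‖ρ b η‖ * ‖ρ b η‖ := by
    rw [inner_self_eq_norm_sq_to_K, ← sq]; simp
  have h2 : ‖ρ b η‖ * ‖ρ b η‖ ≤ ‖ρ b η‖ * (‖MinTensor.of A B y‖ * ‖η‖) := by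
    -- Testing the slice identity at ξ = ρ(b)η turns its right side into ‖ρ(b)η‖². Cauchy–Schwarz
    -- and the bound of π ⊗ ρ by the spatial norm then control ‖ρ(b)η‖, with no slice map on the
    -- completed tensor product.
    have h5 := hcs (v ⊗ₜ[ℂ] ρ b η) (spatialRep π ρ y (v ⊗ₜ[ℂ] η))
    rw [h, hn, h4] at h5
    exact h5.trans (mul_le_mul_of_nonneg_left h3 (norm_nonneg _))
  rcases (norm_nonneg (ρ b η)).eq_or_lt with h0 | h0
  · rw [← h0]; positivity
  · exact le_of_mul_le_mul_left h2 h0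

variable {Γ : Type u} [Group Γ] (N : Subgroup Γ) [N.Normal]

/-- The coaction `g ↦ ḡ ⊗ g` of `C*(Γ/N)` on `C*(Γ)`. -/
def quotientCoaction : GroupCStar Γ →⋆ₐ[ℂ] MinTensor (GroupCStar (Γ ⧸ N)) (GroupCStar Γ) :=
  (MinTensor.map (map (QuotientGroup.mk' N)) (StarAlgHom.id ℂ _)).comp comul

theorem quotientCoaction_δ (g : Γ) :
    quotientCoaction N (δ g) = MinTensor.tmul (δ (g : Γ ⧸ N)) (δ g) := by
  change MinTensor.map _ _ (comul (δ g)) = _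
  rw [comul_δ, MinTensor.map_tmul, map_δ]
  rfl

/-- The truncation of an element of the group algebra to `N` is controlled by its failure to be
fixed by the coaction of `C*(Γ/N)`. -/
theorem exists_truncation (f : MonoidAlgebra ℂ Γ) :
    ∃ e ∈ ofSubgroup N, ‖e - GroupCStar.of f‖ ≤
      ‖quotientCoaction N (GroupCStar.of f) - MinTensor.inr (GroupCStar.of f)‖ := by
  classical
  -- The element y is an algebraic tensor representing the right side, and its slice by the
  -- canonical trace is e - f. Unlike the norm inequality, these conditions are additive in f, so it
  -- suffices to treat a single group element.
  suffices h : ∃ e ∈ ofSubgroup N, ∃ y : GroupCStar (Γ ⧸ N) ⊗[ℂ] GroupCStar Γ,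
      MinTensor.of _ _ y =
        quotientCoaction N (GroupCStar.of f) - MinTensor.inr (GroupCStar.of f) ∧
      ∀ (F : Type u) [NormedAddCommGroup F] [InnerProductSpace ℂ F] [CompleteSpace F]
        (ρ : GroupCStar Γ →⋆ₐ[ℂ] (F →L[ℂ] F)) (ξ η : F),
        inner ℂ (regVec (Γ ⧸ N) ⊗ₜ[ℂ] ξ) (spatialRep (regRep (Γ ⧸ N)) ρ y (regVec _ ⊗ₜ[ℂ] η)) =
          inner ℂ ξ (ρ (e - GroupCStar.of f) η) by
    obtain ⟨e, he, y, hy, h⟩ := h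
    exact ⟨e, he, hy ▸ norm_le_of_slice (regRep _) (norm_regVec _) y _ h⟩
  induction f using MonoidAlgebra.induction_linear with
  | zero => exact ⟨0, zero_mem _, 0, by simp, fun F _ _ _ ρ ξ η => by simp⟩
  | add f g hf hg =>
    obtain ⟨e, he, y, hy, h⟩ := hf
    obtain ⟨e', he', y', hy', h'⟩ := hg
    refine ⟨e + e', add_mem he he', y + y', ?_, fun F _ _ _ ρ ξ η => ?_⟩
    · rw [map_add, hy, hy', map_add, map_add, map_add]; abel
    · rw [map_add (GroupCStar.of), add_sub_add_comm, map_add, map_add, add_apply, add_apply,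
        inner_add_right, inner_add_right, h, h']
  | single m c =>
    have hm : GroupCStar.of (MonoidAlgebra.single m c) = c • δ m := by
      rw [δ, ← map_smul, MonoidAlgebra.smul_single, smul_eq_mul, mul_one]
    have hq : (m : Γ ⧸ N) = 1 ↔ m ∈ N := QuotientGroup.eq_one_iff m
    -- The trace of m̄ is 1 if m ∈ N and 0 otherwise. The slice of c(m̄ ⊗ m - 1 ⊗ m) is thus 0 for m
    -- ∈ N and -cm for m ∉ N, which is e - f in both cases.
    refine ⟨if m ∈ N then c • δ m else 0, ?_,
      c • (δ (m : Γ ⧸ N) ⊗ₜ δ m - 1 ⊗ₜ δ m), ?_, fun F _ _ _ ρ ξ η => ?_⟩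
    · split_ifs with h
      · exact SMulMemClass.smul_mem _ (δ_mem_ofSubgroup h)
      · exact zero_mem _
    · rw [hm, map_smul, map_smul, map_smul, quotientCoaction_δ, ← smul_sub, map_sub]
      rfl
    · have h1 : inner ℂ (regVec (Γ ⧸ N)) (regVec (Γ ⧸ N)) = (1 : ℂ) := by
        rw [inner_self_eq_norm_sq_to_K, norm_regVec]; simp
      rw [hm, map_smul, map_sub, spatialRep_tmul, spatialRep_tmul, smul_apply, sub_apply,
        TensorProduct.mapL_tmul, TensorProduct.mapL_tmul, inner_smul_right, inner_sub_right,
        TensorProduct.inner_tmul, TensorProduct.inner_tmul, inner_regRep, map_one,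
        one_apply_eq_self, h1]
      split_ifs with h2 h3 h3
      · rw [sub_self, sub_self, map_zero, zero_apply, inner_zero_right, mul_zero]
      · exact absurd (hq.1 h2) h3
      · exact absurd (hq.2 h3) h2
      · rw [zero_mul, zero_sub, zero_sub, one_mul, ← smul_neg, map_smul, map_neg, smul_apply,
          neg_apply, inner_smul_right, inner_neg_right]

/-- The fixed points of the coaction of `C*(Γ/N)` on `C*(Γ)` form the algebra `C*(N)`. -/
theorem equalizer_quotientCoaction :
    StarAlgHom.equalizer (quotientCoaction N) MinTensor.inr = ofSubgroup N := by
  apply le_antisymm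
  · intro x hx
    have hx : quotientCoaction N x = MinTensor.inr x := hx
    have hcl := (isClosed_ofSubgroup N).closure_eq
    change x ∈ (ofSubgroup N : Set (GroupCStar Γ))
    rw [← hcl, Metric.mem_closure_iff]
    intro ε hε
    -- The bound ε/3 is spent once on ‖x - a‖ and twice on ‖a - e‖, which is at most 2‖x - a‖.
    obtain ⟨a, ha⟩ := Metric.denseRange_iff.1 ((groupSeminorm Γ).denseRange_of) x (ε / 3)
      (by positivity)
    change dist x (GroupCStar.of a) < ε / 3 at ha
    obtain ⟨e, he, h⟩ := exists_truncation N a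
    refine ⟨e, he, ?_⟩
    rw [dist_eq_norm] at ha
    -- As x is fixed, the failure of a to be fixed depends only on x - a. Both *-homomorphisms are
    -- contractive, which gives the factor 2.
    have h1 : quotientCoaction N (GroupCStar.of a) - MinTensor.inr (GroupCStar.of a) =
        MinTensor.inr (x - GroupCStar.of a) - quotientCoaction N (x - GroupCStar.of a) := by
      rw [map_sub, map_sub, hx]; abel
    have h2 : ‖(MinTensor.inr (x - GroupCStar.of a) :
        MinTensor (GroupCStar (Γ ⧸ N)) (GroupCStar Γ))‖ ≤ ‖x - GroupCStar.of a‖ :=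
      NonUnitalStarAlgHom.norm_apply_le _ _
    have h3 : ‖quotientCoaction N (x - GroupCStar.of a)‖ ≤ ‖x - GroupCStar.of a‖ :=
      NonUnitalStarAlgHom.norm_apply_le _ _
    rw [h1] at h
    have h4 := h.trans (norm_sub_le _ _)
    rw [norm_sub_rev] at h4
    calc dist x e = ‖(x - GroupCStar.of a) + (GroupCStar.of a - e)‖ := by
          rw [dist_eq_norm, sub_add_sub_cancel]
      _ ≤ ‖x - GroupCStar.of a‖ + ‖GroupCStar.of a - e‖ := norm_add_le _ _
      _ < ε := by linarith
  · refine ofSubgroup_le (isClosed_eq (continuous_hom _) (continuous_hom _)) fun g hg => ?_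
    change quotientCoaction N (δ g) = MinTensor.tmul 1 (δ g)
    rw [quotientCoaction_δ, (QuotientGroup.eq_one_iff g).2 hg, δ_one]

/-- The algebra `C(G/H)` does not change when `H` is replaced by an isomorphic quantum subgroup. -/
theorem QuantumSubgroup.quotientAlgebra_congr {n : ℕ} {K L G : QuantumSubgroup.{u} n}
    (h : K.Isomorphic L) (hK : K.IsSubgroup G) (hL : L.IsSubgroup G) :
    quotientAlgebra hK = quotientAlgebra hL := by
  obtain ⟨θ, -, hθ⟩ := h
  let a : K.carrier →⋆ₐ[ℂ] L.carrier := θ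
  let b : L.carrier →⋆ₐ[ℂ] K.carrier := θ.symm
  have ha : a.comp (restrict hK) = restrict hL := by
    ext y
    obtain ⟨x, rfl⟩ := G.surjective y
    change θ (restrict hK (G.proj x)) = _
    rw [restrict_proj, restrict_proj, hθ]
  have hb : b.comp (restrict hL) = restrict hK := by
    ext y
    obtain ⟨x, rfl⟩ := G.surjective y
    change θ.symm (restrict hL (G.proj x)) = _
    rw [restrict_proj, restrict_proj, ← hθ, StarAlgEquiv.symm_apply_apply]
  have key : ∀ {P Q : QuantumSubgroup.{u} n} (hP : P.IsSubgroup G) (hQ : Q.IsSubgroup G)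
      (c : P.carrier →⋆ₐ[ℂ] Q.carrier), c.comp (restrict hP) = restrict hQ →
      quotientAlgebra hP ≤ quotientAlgebra hQ := by
    intro P Q hP hQ c hc f hf
    rw [mem_quotientAlgebra] at hf ⊢
    -- Applying c ⊗ id to the equation (π ⊗ id)Δf = 1 ⊗ f replaces the restriction morphism of P by
    -- that of Q.
    have h1 := congrArg (MinTensor.map c (StarAlgHom.id ℂ G.carrier)) hf
    rw [MinTensor.map_map, MinTensor.map_tmul, hc, map_one] at h1
    exact h1
  exact le_antisymm (key hK hL a ha) (key hL hK b hb)

theorem dual_isSubgroup {n : ℕ} (g : Fin n → Γ) (hg : Subgroup.closure (Set.range g) = ⊤)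
    (J : Matrix.unitaryGroup (Fin n) ℂ) :
    (dual (fun r => (QuotientGroup.mk (g r) : Γ ⧸ N)) (closure_range_mk hg N) J).IsSubgroup
      (dual g hg J) := by
  intro x hx
  refine (dual_quotient_proj g hg J N x).trans ?_
  exact (congrArg (map (QuotientGroup.mk' N)) ((RingHom.mem_ker).1 hx)).trans (map_zero _)

/-- The restriction morphism is determined by its composite with C(U_n⁺) → C*(Γ), so it is the one
induced by Γ → Γ/N. The equation defining C(G/H) then becomes the fixed point equation of the
coaction. -/
theorem quotientAlgebra_dual {n : ℕ} (g : Fin n → Γ) (hg : Subgroup.closure (Set.range g) = ⊤)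
    (J : Matrix.unitaryGroup (Fin n) ℂ) :
    quotientAlgebra (dual_isSubgroup N g hg J) =
      StarAlgHom.equalizer (quotientCoaction N) MinTensor.inr := by
  have h : restrict (dual_isSubgroup N g hg J) = map (QuotientGroup.mk' N) := by
    refine DFunLike.ext _ _ fun y => ?_
    obtain ⟨x, rfl⟩ := (dual g hg J).surjective y
    exact (restrict_proj _ x).trans (dual_quotient_proj g hg J N x)
  rw [quotientAlgebra, h]
  rfl

end Quotient

end

end QSpace

/-! ### Assembly of the four statements -/

theorem theorem2p5 {Γ : Type u} [Group Γ] {n k : ℕ} (hk : k ≤ n) (g : Fin n → Γ)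
    (hg : Subgroup.closure (Set.range g) = ⊤) (J : Matrix.unitaryGroup (Fin n) ℂ)
    (Λ Λ' : Subgroup Γ) (hΛ : Λ = Subgroup.closure (QSpace.rowSet g J k))
    (hΛ' : Λ' = Subgroup.normalClosure (Λ : Set Γ)) :
    ((QSpace.dual g hg J).inter (QSpace.uPlusSubgroup hk)).Isomorphic
        (QSpace.dual
          (fun r => (QuotientGroup.mk (g r) : Γ ⧸ Subgroup.normalClosure (QSpace.rowSet g J k)))
          (QSpace.closure_range_mk hg (Subgroup.normalClosure (QSpace.rowSet g J k))) J) ∧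
      (Function.Injective (QSpace.GroupCStar.map Λ.subtype) ∧
        (QSpace.dual g hg J).rowAlgebra k = QSpace.GroupCStar.ofSubgroup Λ) ∧
      (Function.Injective (QSpace.GroupCStar.map Λ'.subtype) ∧
        QSpace.QuantumSubgroup.quotientAlgebra
            ((QSpace.dual g hg J).inter_isSubgroup_left (QSpace.uPlusSubgroup hk)) =
          QSpace.GroupCStar.ofSubgroup Λ') ∧
      ((QSpace.dual g hg J).rowAlgebra k =
          QSpace.QuantumSubgroup.quotientAlgebra
            ((QSpace.dual g hg J).inter_isSubgroup_left (QSpace.uPlusSubgroup hk)) ↔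
        Λ.Normal) := by
  have h1 := QSpace.inter_uPlusSubgroup_isomorphic hk g hg J
  have h2 : (QSpace.dual g hg J).rowAlgebra k = QSpace.GroupCStar.ofSubgroup Λ :=
    hΛ ▸ QSpace.rowAlgebra_dual g hg J k
  -- The normal closure of Λ equals that of its generators, so the group divided out in Θ is Λ'.
  have hN : Λ' = Subgroup.normalClosure (QSpace.rowSet g J k) := by
    rw [hΛ', hΛ]
    refine le_antisymm (Subgroup.normalClosure_le_normal ?_)
      (Subgroup.normalClosure_mono Subgroup.subset_closure)
    exact (Subgroup.closure_le _).2 Subgroup.subset_normalClosure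
  have h3 : QSpace.QuantumSubgroup.quotientAlgebra
      ((QSpace.dual g hg J).inter_isSubgroup_left (QSpace.uPlusSubgroup hk)) =
        QSpace.GroupCStar.ofSubgroup Λ' := by
    rw [hN, ← QSpace.equalizer_quotientCoaction]
    exact (QSpace.QuantumSubgroup.quotientAlgebra_congr h1 _ (QSpace.dual_isSubgroup _ g hg J)).trans
      (QSpace.quotientAlgebra_dual _ g hg J)
  refine ⟨h1, ⟨QSpace.GroupCStar.map_subtype_injective Λ, h2⟩,
    ⟨QSpace.GroupCStar.map_subtype_injective Λ', h3⟩, ?_⟩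
  rw [h2, h3]
  -- The algebras agree if and only if Λ = Λ', and a subgroup equals its normal closure exactly when
  -- it is normal.
  refine QSpace.GroupCStar.ofSubgroup_injective.eq_iff.trans ?_
  constructor
  · intro h
    rw [h, hΛ']
    exact Subgroup.normalClosure_normal
  · intro h
    rw [hΛ', Subgroup.normalClosure_eq_self]
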